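/- Let ZFG[0] be the first-order theory, in the language with membership $\in$ and a further binary relation $\leq_\gamma$, whose axioms are those of Zermelo--Fraenkel set theory without the power set axiom (extensionality, foundation, pairing, union, infinity, separation, replacement) together with: $\leq_\gamma$ is a linear order on all sets, and every non-empty definable class has a $\leq_\gamma$-least element; the separation, replacement and least-element schemes include formulas that use $\leq_\gamma$. Rings are commutative with unit, a topological space is a set of points with a set of open subsets, and a Noetherian scheme is a ringed space with a finite cover by open subspaces isomorphic to spectra of Noetherian rings. Given an open subspace $U\cong\mathrm{Spec}(R)$ of a scheme with $R$ Noetherian, a finite digraph of global generators is a finite rooted directed graph, with all nodes reachable from the root, whose nodes are pairs $\langle D(f),G_f\rangle$ with $D(f)$ a distinguished open set and $G_f$ a finite subset of $R$; each node stands for the ideal $K$ of $R_f$ generated by $G_f$. The open set of the root is $\mathrm{Spec}(R)$, each $D(f)$ occurs in at most one node, and for every edge from $\langle D(g),G_g\rangle$ to $\langle D(f),G_f\rangle$, with ideals $H$ and $K$, one has $D(f)\subsetneq D(g)$ and $K$ properly contains the localization $H_f$ of $H$ to $D(f)$. It generates a sheaf of ideals $\mathscr{I}$ on $U$ if $\mathscr{I}$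 is the smallest sheaf of ideals on $U$ having every $s\in G_f$, restricted to $D(f)$, among its sections over $D(f)$, for all nodes. Theorem. ZFG[0] proves (that is, every model of ZFG[0] satisfies) the following. Let $X$ be a Noetherian scheme and $\mathscr{M}$ a sheaf of $\mathcal{O}_X$-modules. 1. For every sheaf of ideals $\mathscr{I}\subseteq\mathcal{O}_X$ there is a set $(\mathscr{I},\mathscr{M})$ of all $\mathcal{O}_X$-module maps $\mathscr{I}\to\mathscr{M}$. 2. For fixed $\mathscr{M}$ there is a set of all the sets $(\mathscr{I},\mathscr{M})$, where $\mathscr{I}$ runs over all sheaves of ideals of $\mathcal{O}_X$. 3. Let $\mathscr{I}$ be a sheaf of ideals. For each open $U\cong\mathrm{Spec}(R)$ with $R$ Noetherian, $\mathscr{I}|_U$ is generated by a finite digraph of global generators. For each such digraph generating $\mathscr{I}|_U$, two $\mathcal{O}_X$-module maps $\mathscr{I}\to\mathscr{M}$ that take the same values on the finitely many generators $s|_{D(f)}$, for $s\in G_f$ and $\langle D(f),G_f\rangle$ a node, agree on all open subsets of $U$. If $X$ is covered by open sets of this kind and two maps $\mathscr{I}\to\mathscr{M}$ agree on the generators of such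 a digraph over each member of the cover (so on finitely many generators, when the cover is finite), then the two maps are equal. -/

import Mathlib

universe u

/-! ### The language and the theory

A universe of sets is a type `V` with two binary relations: membership and the global order.
Everything below that speaks about sets, rings, spaces, sheaves and maps inside `V` quantifies
over elements of `V` only, so it is a first-order notion in the language of these two relations. -/

/-- The relation symbols of the language: membership and the global order. -/
inductive SetSymbol : ℕ → Type
  | mem : SetSymbol 2
  | le : SetSymbol 2

/-- The first-order language with two binary relation symbols and no function symbols. -/
def setLang : FirstOrder.Language.{0, 0} := ⟨fun _ => Empty, SetSymbol⟩

/-- A type with a membership relation and a global order. -/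
class SetUniverse (V : Type u) where
  mem : V → V → Prop
  le : V → V → Prop

infix:50 " ∈ᵥ " => SetUniverse.mem
infix:50 " ≤ᵥ " => SetUniverse.le

instance SetUniverse.toStructure (V : Type u) [SetUniverse V] : setLang.Structure V where
  funMap := fun f => Empty.elim f
  RelMap := fun {n} (r : SetSymbol n) =>
    match n, r with
    | _, SetSymbol.mem => fun x => x 0 ∈ᵥ x 1
    | _, SetSymbol.le => fun x => x 0 ≤ᵥ x 1

namespace ZFG

variable {V : Type u} [SetUniverse V]

/-- Inclusion of sets. -/
def Sub (a b : V) : Prop := ∀ x : V, x ∈ᵥ a → x ∈ᵥ b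

infix:50 " ⊆ᵥ " => Sub

/-- `w` contains the empty set and is closed under `x ↦ x ∪ {x}`. -/
def IsInductive (w : V) : Prop :=
  (∃ e : V, e ∈ᵥ w ∧ ∀ x : V, ¬ x ∈ᵥ e) ∧
  ∀ x : V, x ∈ᵥ w → ∃ s : V, s ∈ᵥ w ∧ ∀ z : V, z ∈ᵥ s ↔ (z ∈ᵥ x ∨ z = x)

variable (V) in
/-- `V` is a model of `ZFG[0]`: Zermelo-Fraenkel set theory without the power set axiom, with a
global well-ordering. The schemes of separation, replacement and global well-ordering range over
all classes that are definable with parameters by formulas in membership and the global order. -/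
structure IsModelZFG0 : Prop where
  extensionality : ∀ a b : V, (∀ x : V, x ∈ᵥ a ↔ x ∈ᵥ b) → a = b
  foundation : ∀ a : V, (∃ x : V, x ∈ᵥ a) → ∃ x : V, x ∈ᵥ a ∧ ∀ y : V, ¬ (y ∈ᵥ a ∧ y ∈ᵥ x)
  pairing : ∀ a b : V, ∃ c : V, ∀ x : V, x ∈ᵥ c ↔ (x = a ∨ x = b)
  union : ∀ a : V, ∃ c : V, ∀ x : V, x ∈ᵥ c ↔ ∃ y : V, y ∈ᵥ a ∧ x ∈ᵥ y
  infinity : ∃ w : V, IsInductive w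
  separation : ∀ P : Set V, (Set.univ : Set V).Definable₁ setLang P →
    ∀ a : V, ∃ b : V, ∀ x : V, x ∈ᵥ b ↔ (x ∈ᵥ a ∧ x ∈ P)
  replacement : ∀ F : Set (V × V), (Set.univ : Set V).Definable₂ setLang F →
    ∀ a : V, (∀ x : V, x ∈ᵥ a → ∃! y : V, (x, y) ∈ F) →
      ∃ b : V, ∀ y : V, y ∈ᵥ b ↔ ∃ x : V, x ∈ᵥ a ∧ (x, y) ∈ F
  le_refl : ∀ x : V, x ≤ᵥ x
  le_antisymm : ∀ x y : V, x ≤ᵥ y → y ≤ᵥ x → x = y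
  le_trans : ∀ x y z : V, x ≤ᵥ y → y ≤ᵥ z → x ≤ᵥ z
  le_total : ∀ x y : V, x ≤ᵥ y ∨ y ≤ᵥ x
  exists_least : ∀ P : Set V, (Set.univ : Set V).Definable₁ setLang P → P.Nonempty →
    ∃ x : V, x ∈ P ∧ ∀ y : V, y ∈ P → x ≤ᵥ y

/-! ### Sets, pairs, functions, finiteness -/

open Classical in
/-- The unique `y` with `P y`; if there is no such unique `y`, the default `d`. -/
noncomputable def the (P : V → Prop) (d : V) : V := if h : ∃! y : V, P y then h.choose else d

/-- `z = {x, y}`. -/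
def IsUPair (z x y : V) : Prop := ∀ w : V, w ∈ᵥ z ↔ (w = x ∨ w = y)

/-- The ordered pair `{{x, x}, {x, y}}`. -/
noncomputable def pair (x y : V) : V :=
  the (fun p => ∀ z : V, z ∈ᵥ p ↔ (IsUPair z x x ∨ IsUPair z x y)) x

/-- The value at `x` of a function `f`, given as a set of ordered pairs. -/
noncomputable def val (f x : V) : V := the (fun y => pair x y ∈ᵥ f) x

/-- The value at `(x, y)` of a function of two variables. -/
noncomputable def val₂ (f x y : V) : V := val f (pair x y)

/-- `f` is (the graph of) a function from `A` to `B`. -/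
def IsFun (f A B : V) : Prop :=
  (∀ p : V, p ∈ᵥ f → ∃ x y : V, x ∈ᵥ A ∧ y ∈ᵥ B ∧ p = pair x y) ∧
  ∀ x : V, x ∈ᵥ A → ∃! y : V, pair x y ∈ᵥ f

/-- `f` is (the graph of) a function from `A × B` to `C`. -/
def IsFun₂ (f A B C : V) : Prop :=
  (∀ p : V, p ∈ᵥ f → ∃ x y z : V, x ∈ᵥ A ∧ y ∈ᵥ B ∧ z ∈ᵥ C ∧ p = pair (pair x y) z) ∧
  ∀ x y : V, x ∈ᵥ A → y ∈ᵥ B → ∃! z : V, pair (pair x y) z ∈ᵥ f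

/-- `f` is a family indexed by the `x` with `D x`: a function with exactly this domain. -/
def IsFamily (f : V) (D : V → Prop) : Prop :=
  (∀ p : V, p ∈ᵥ f → ∃ x y : V, D x ∧ p = pair x y) ∧
  ∀ x : V, D x → ∃! y : V, pair x y ∈ᵥ f

/-- `n` is a natural number (an element of `ω`). -/
def IsNat (n : V) : Prop := ∀ w : V, IsInductive w → n ∈ᵥ w

/-- `A` is in bijection with a natural number. -/
def IsFinite (A : V) : Prop :=
  ∃ n f : V, IsNat n ∧ IsFun f n A ∧ ∀ y : V, y ∈ᵥ A → ∃! x : V, x ∈ᵥ n ∧ pair x y ∈ᵥ f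

/-! ### Commutative rings -/

variable (V) in
/-- A set with two operations and two elements. -/
structure RingData where
  car : V
  add : V
  mul : V
  zero : V
  one : V

noncomputable def RingData.plus (R : RingData V) (x y : V) : V := val₂ R.add x y

noncomputable def RingData.times (R : RingData V) (x y : V) : V := val₂ R.mul x y

/-- Commutative rings with unit. -/
structure IsCommRing (R : RingData V) : Prop where
  add_fun : IsFun₂ R.add R.car R.car R.car
  mul_fun : IsFun₂ R.mul R.car R.car R.car
  zero_mem : R.zero ∈ᵥ R.car
  one_mem : R.one ∈ᵥ R.car
  add_assoc : ∀ x y z : V, x ∈ᵥ R.car → y ∈ᵥ R.car → z ∈ᵥ R.car →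
    R.plus (R.plus x y) z = R.plus x (R.plus y z)
  add_comm : ∀ x y : V, x ∈ᵥ R.car → y ∈ᵥ R.car → R.plus x y = R.plus y x
  zero_add : ∀ x : V, x ∈ᵥ R.car → R.plus R.zero x = x
  exists_neg : ∀ x : V, x ∈ᵥ R.car → ∃ y : V, y ∈ᵥ R.car ∧ R.plus y x = R.zero
  mul_assoc : ∀ x y z : V, x ∈ᵥ R.car → y ∈ᵥ R.car → z ∈ᵥ R.car →
    R.times (R.times x y) z = R.times x (R.times y z)
  mul_comm : ∀ x y : V, x ∈ᵥ R.car → y ∈ᵥ R.car → R.times x y = R.times y x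
  one_mul : ∀ x : V, x ∈ᵥ R.car → R.times R.one x = x
  left_distrib : ∀ x y z : V, x ∈ᵥ R.car → y ∈ᵥ R.car → z ∈ᵥ R.car →
    R.times x (R.plus y z) = R.plus (R.times x y) (R.times x z)

/-- The operation `j` is a ring homomorphism from `R` to `S`. -/
structure IsRingHom (R S : RingData V) (j : V → V) : Prop where
  map_mem : ∀ x : V, x ∈ᵥ R.car → j x ∈ᵥ S.car
  map_one : j R.one = S.one
  map_add : ∀ x y : V, x ∈ᵥ R.car → y ∈ᵥ R.car → j (R.plus x y) = S.plus (j x) (j y)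
  map_mul : ∀ x y : V, x ∈ᵥ R.car → y ∈ᵥ R.car → j (R.times x y) = S.times (j x) (j y)

/-- `J` is an ideal of `R`. -/
structure IsIdeal (R : RingData V) (J : V) : Prop where
  sub : J ⊆ᵥ R.car
  zero_mem : R.zero ∈ᵥ J
  add_mem : ∀ x y : V, x ∈ᵥ J → y ∈ᵥ J → R.plus x y ∈ᵥ J
  mul_mem : ∀ a x : V, a ∈ᵥ R.car → x ∈ᵥ J → R.times a x ∈ᵥ J

/-- `p` is a prime ideal of `R`. -/
structure IsPrimeIdeal (R : RingData V) (p : V) : Prop where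
  ideal : IsIdeal R p
  one_notMem : ¬ R.one ∈ᵥ p
  mem_or_mem : ∀ x y : V, x ∈ᵥ R.car → y ∈ᵥ R.car → R.times x y ∈ᵥ p → x ∈ᵥ p ∨ y ∈ᵥ p

/-- `R` is a Noetherian ring: every ideal is generated by a finite subset. -/
def IsNoetherianRing (R : RingData V) : Prop :=
  IsCommRing R ∧ ∀ J : V, IsIdeal R J →
    ∃ G : V, IsFinite G ∧ G ⊆ᵥ J ∧ ∀ J' : V, IsIdeal R J' → G ⊆ᵥ J' → J ⊆ᵥ J'

/-- `e` is one of the powers `1, f, f ^ 2, …` of `f` in `R`. -/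
def IsPower (R : RingData V) (f e : V) : Prop :=
  ∀ S : V, R.one ∈ᵥ S → (∀ x : V, x ∈ᵥ S → R.times f x ∈ᵥ S) → e ∈ᵥ S

/-- `j` exhibits `S` as the localization `R_f` of `R` at the powers of `f`. -/
structure IsLocalizationAway (R : RingData V) (f : V) (S : RingData V) (j : V → V) : Prop where
  hom : IsRingHom R S j
  isUnit : ∃ t : V, t ∈ᵥ S.car ∧ S.times (j f) t = S.one
  surj : ∀ s : V, s ∈ᵥ S.car → ∃ a e : V, a ∈ᵥ R.car ∧ IsPower R f e ∧ S.times s (j e) = j a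
  eq_of_map_eq : ∀ a b : V, a ∈ᵥ R.car → b ∈ᵥ R.car → j a = j b →
    ∃ e : V, IsPower R f e ∧ R.times e a = R.times e b

/-! ### Topological spaces and sheaves -/

/-- `T` is the set of open sets of a topology on the set `X`. -/
structure IsTopology (X T : V) : Prop where
  sub : ∀ U : V, U ∈ᵥ T → U ⊆ᵥ X
  univ : X ∈ᵥ T
  inter : ∀ U W : V, U ∈ᵥ T → W ∈ᵥ T →
    ∃ N : V, N ∈ᵥ T ∧ ∀ x : V, x ∈ᵥ N ↔ (x ∈ᵥ U ∧ x ∈ᵥ W)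
  sUnion : ∀ S : V, S ⊆ᵥ T → ∃ N : V, N ∈ᵥ T ∧ ∀ x : V, x ∈ᵥ N ↔ ∃ U : V, U ∈ᵥ S ∧ x ∈ᵥ U

/-- `S` is a covering of `U` by open sets; `Op` tells which sets are open. -/
def IsCover (Op : V → Prop) (U S : V) : Prop :=
  (∀ W : V, W ∈ᵥ S → Op W) ∧ ∀ x : V, x ∈ᵥ U ↔ ∃ W : V, W ∈ᵥ S ∧ x ∈ᵥ W

/-- The restriction to `W` of a section `s` over `U`. -/
noncomputable def restr (res U W s : V) : V := val (val₂ res U W) s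

/-- The values `val F U` with the restrictions `restr res` form a sheaf of sets on the space
whose open sets are the `U` with `Op U`. -/
structure IsSheaf (Op : V → Prop) (F res : V) : Prop where
  restr_mem : ∀ U W s : V, Op U → Op W → W ⊆ᵥ U → s ∈ᵥ val F U → restr res U W s ∈ᵥ val F W
  restr_self : ∀ U s : V, Op U → s ∈ᵥ val F U → restr res U U s = s
  restr_restr : ∀ U W N s : V, Op U → Op W → Op N → W ⊆ᵥ U → N ⊆ᵥ W → s ∈ᵥ val F U →
    restr res W N (restr res U W s) = restr res U N s
  eq_of_locally_eq : ∀ U S s t : V, Op U → IsCover Op U S → s ∈ᵥ val F U → t ∈ᵥ val F U →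
    (∀ W : V, W ∈ᵥ S → restr res U W s = restr res U W t) → s = t
  glue : ∀ U S c : V, Op U → IsCover Op U S → IsFamily c (fun W => W ∈ᵥ S) →
    (∀ W : V, W ∈ᵥ S → val c W ∈ᵥ val F W) →
    (∀ W W' N : V, W ∈ᵥ S → W' ∈ᵥ S → (∀ x : V, x ∈ᵥ N ↔ (x ∈ᵥ W ∧ x ∈ᵥ W')) →
      restr res W N (val c W) = restr res W' N (val c W')) →
    ∃ s : V, s ∈ᵥ val F U ∧ ∀ W : V, W ∈ᵥ S → restr res U W s = val c W

/-- The pairs `(U, W)` of elements of `T` with `W ⊆ U`. -/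
def IsOpenPair (T q : V) : Prop := ∃ U W : V, U ∈ᵥ T ∧ W ∈ᵥ T ∧ W ⊆ᵥ U ∧ q = pair U W

/-! ### Ringed spaces and schemes -/

variable (V) in
/-- The data of a ringed space: a set of points, a set of open sets, families
`car, add, mul, zero, one` that give the ring of sections over each open set, and a family `res`
that gives for open sets `W ⊆ U` the restriction map. -/
structure RingedSpace where
  pts : V
  opens : V
  car : V
  add : V
  mul : V
  zero : V
  one : V
  res : V

/-- The ring of sections over `U`. -/
noncomputable def RingedSpace.ring (X : RingedSpace V) (U : V) : RingData V :=
  ⟨val X.car U, val X.add U, val X.mul U, val X.zero U, val X.one U⟩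

/-- `W` is an open set contained in `U`. -/
def RingedSpace.OpenIn (X : RingedSpace V) (U W : V) : Prop := W ∈ᵥ X.opens ∧ W ⊆ᵥ U

/-- `X` is a topological space with a sheaf of commutative rings. -/
structure IsRingedSpace (X : RingedSpace V) : Prop where
  top : IsTopology X.pts X.opens
  car_family : IsFamily X.car (fun U => U ∈ᵥ X.opens)
  add_family : IsFamily X.add (fun U => U ∈ᵥ X.opens)
  mul_family : IsFamily X.mul (fun U => U ∈ᵥ X.opens)
  zero_family : IsFamily X.zero (fun U => U ∈ᵥ X.opens)
  one_family : IsFamily X.one (fun U => U ∈ᵥ X.opens)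
  res_family : IsFamily X.res (IsOpenPair X.opens)
  isCommRing : ∀ U : V, U ∈ᵥ X.opens → IsCommRing (X.ring U)
  res_fun : ∀ U W : V, U ∈ᵥ X.opens → W ∈ᵥ X.opens → W ⊆ᵥ U →
    IsFun (val₂ X.res U W) (val X.car U) (val X.car W)
  res_hom : ∀ U W : V, U ∈ᵥ X.opens → W ∈ᵥ X.opens → W ⊆ᵥ U →
    IsRingHom (X.ring U) (X.ring W) (restr X.res U W)
  sheaf : IsSheaf (X.OpenIn X.pts) X.car X.res

/-- `W` is the preimage of the distinguished open set `D(f)` under the map `θ` from `U` to the set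
of prime ideals of a ring. -/
def IsDistinguished (U θ f W : V) : Prop := ∀ x : V, x ∈ᵥ W ↔ (x ∈ᵥ U ∧ ¬ f ∈ᵥ val θ x)

/-- The pair `(θ, ρ)` is an isomorphism of the open subspace `U` of the ringed space `X` with the
spectrum of the ring `R`: `θ` is a homeomorphism from `U` to the set of all prime ideals of `R`,
whose open sets are the complements of the sets `V(J)` for ideals `J`, and `ρ` is a map from `R` to
the sections over `U` such that the sections over each distinguished open set `D(f)` are the
localization `R_f`. -/
structure IsAffineChart (X : RingedSpace V) (U : V) (R : RingData V) (θ ρ : V) : Prop where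
  isOpen : U ∈ᵥ X.opens
  θ_family : IsFamily θ (fun x => x ∈ᵥ U)
  θ_prime : ∀ x : V, x ∈ᵥ U → IsPrimeIdeal R (val θ x)
  θ_inj : ∀ x y : V, x ∈ᵥ U → y ∈ᵥ U → val θ x = val θ y → x = y
  θ_surj : ∀ p : V, IsPrimeIdeal R p → ∃ x : V, x ∈ᵥ U ∧ val θ x = p
  open_iff : ∀ W : V, W ⊆ᵥ U → (W ∈ᵥ X.opens ↔
    ∃ J : V, IsIdeal R J ∧ ∀ x : V, x ∈ᵥ U → (x ∈ᵥ W ↔ ¬ J ⊆ᵥ val θ x))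
  ρ_fun : IsFun ρ R.car (val X.car U)
  localization : ∀ f W : V, f ∈ᵥ R.car → IsDistinguished U θ f W →
    IsLocalizationAway R f (X.ring W) (fun a => restr X.res U W (val ρ a))

/-- `X` is a Noetherian scheme: a ringed space with a finite covering by open subspaces that are
isomorphic to spectra of Noetherian rings. -/
def IsNoetherianScheme (X : RingedSpace V) : Prop :=
  IsRingedSpace X ∧ ∃ C : V, IsFinite C ∧ IsCover (X.OpenIn X.pts) X.pts C ∧
    ∀ U : V, U ∈ᵥ C → ∃ (R : RingData V) (θ ρ : V),
      IsNoetherianRing R ∧ IsAffineChart X U R θ ρ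

/-! ### Sheaves of ideals, sheaves of modules, module maps -/

/-- `I` is a sheaf of ideals of the structure sheaf of the open subspace `U` of `X`: a family of
ideals, indexed by the open sets in `U`, that is a subsheaf. -/
structure IsIdealSheafOn (X : RingedSpace V) (U I : V) : Prop where
  family : IsFamily I (X.OpenIn U)
  ideal : ∀ W : V, X.OpenIn U W → IsIdeal (X.ring W) (val I W)
  sheaf : IsSheaf (X.OpenIn U) I X.res

/-- Sheaves of ideals of the structure sheaf of `X`. -/
def IsIdealSheaf (X : RingedSpace V) (I : V) : Prop := IsIdealSheafOn X X.pts I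

variable (V) in
/-- The data of a sheaf of modules: families that give for each open set the set of sections, its
addition, its zero and the scalar multiplication, and the family of the restriction maps. -/
structure ModuleSheaf where
  car : V
  add : V
  zero : V
  smul : V
  res : V

noncomputable def ModuleSheaf.plus (M : ModuleSheaf V) (U m n : V) : V := val₂ (val M.add U) m n

noncomputable def ModuleSheaf.act (M : ModuleSheaf V) (U a m : V) : V := val₂ (val M.smul U) a m

/-- `M` is a sheaf of modules over the structure sheaf of `X`. -/
structure IsModuleSheaf (X : RingedSpace V) (M : ModuleSheaf V) : Prop where
  car_family : IsFamily M.car (fun U => U ∈ᵥ X.opens)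
  add_family : IsFamily M.add (fun U => U ∈ᵥ X.opens)
  zero_family : IsFamily M.zero (fun U => U ∈ᵥ X.opens)
  smul_family : IsFamily M.smul (fun U => U ∈ᵥ X.opens)
  res_family : IsFamily M.res (IsOpenPair X.opens)
  add_fun : ∀ U : V, U ∈ᵥ X.opens →
    IsFun₂ (val M.add U) (val M.car U) (val M.car U) (val M.car U)
  smul_fun : ∀ U : V, U ∈ᵥ X.opens →
    IsFun₂ (val M.smul U) (val X.car U) (val M.car U) (val M.car U)
  zero_mem : ∀ U : V, U ∈ᵥ X.opens → val M.zero U ∈ᵥ val M.car U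
  add_assoc : ∀ U l m n : V, U ∈ᵥ X.opens → l ∈ᵥ val M.car U → m ∈ᵥ val M.car U →
    n ∈ᵥ val M.car U → M.plus U (M.plus U l m) n = M.plus U l (M.plus U m n)
  add_comm : ∀ U m n : V, U ∈ᵥ X.opens → m ∈ᵥ val M.car U → n ∈ᵥ val M.car U →
    M.plus U m n = M.plus U n m
  zero_add : ∀ U m : V, U ∈ᵥ X.opens → m ∈ᵥ val M.car U → M.plus U (val M.zero U) m = m
  exists_neg : ∀ U m : V, U ∈ᵥ X.opens → m ∈ᵥ val M.car U →
    ∃ n : V, n ∈ᵥ val M.car U ∧ M.plus U n m = val M.zero U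
  one_act : ∀ U m : V, U ∈ᵥ X.opens → m ∈ᵥ val M.car U → M.act U (val X.one U) m = m
  mul_act : ∀ U a b m : V, U ∈ᵥ X.opens → a ∈ᵥ val X.car U → b ∈ᵥ val X.car U →
    m ∈ᵥ val M.car U → M.act U ((X.ring U).times a b) m = M.act U a (M.act U b m)
  add_act : ∀ U a b m : V, U ∈ᵥ X.opens → a ∈ᵥ val X.car U → b ∈ᵥ val X.car U →
    m ∈ᵥ val M.car U → M.act U ((X.ring U).plus a b) m = M.plus U (M.act U a m) (M.act U b m)
  act_add : ∀ U a m n : V, U ∈ᵥ X.opens → a ∈ᵥ val X.car U → m ∈ᵥ val M.car U →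
    n ∈ᵥ val M.car U → M.act U a (M.plus U m n) = M.plus U (M.act U a m) (M.act U a n)
  res_fun : ∀ U W : V, U ∈ᵥ X.opens → W ∈ᵥ X.opens → W ⊆ᵥ U →
    IsFun (val₂ M.res U W) (val M.car U) (val M.car W)
  res_add : ∀ U W m n : V, U ∈ᵥ X.opens → W ∈ᵥ X.opens → W ⊆ᵥ U →
    m ∈ᵥ val M.car U → n ∈ᵥ val M.car U →
    restr M.res U W (M.plus U m n) = M.plus W (restr M.res U W m) (restr M.res U W n)
  res_act : ∀ U W a m : V, U ∈ᵥ X.opens → W ∈ᵥ X.opens → W ⊆ᵥ U →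
    a ∈ᵥ val X.car U → m ∈ᵥ val M.car U →
    restr M.res U W (M.act U a m) = M.act W (restr X.res U W a) (restr M.res U W m)
  sheaf : IsSheaf (X.OpenIn X.pts) M.car M.res

/-- `φ` is a map of sheaves of modules over the structure sheaf of `X` from the sheaf of ideals `I`
to `M`: a family, indexed by the open sets, of linear functions that commute with restriction. -/
structure IsModuleMap (X : RingedSpace V) (I : V) (M : ModuleSheaf V) (φ : V) : Prop where
  family : IsFamily φ (fun U => U ∈ᵥ X.opens)
  isFun : ∀ U : V, U ∈ᵥ X.opens → IsFun (val φ U) (val I U) (val M.car U)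
  map_add : ∀ U s t : V, U ∈ᵥ X.opens → s ∈ᵥ val I U → t ∈ᵥ val I U →
    val (val φ U) ((X.ring U).plus s t) = M.plus U (val (val φ U) s) (val (val φ U) t)
  map_mul : ∀ U a s : V, U ∈ᵥ X.opens → a ∈ᵥ val X.car U → s ∈ᵥ val I U →
    val (val φ U) ((X.ring U).times a s) = M.act U a (val (val φ U) s)
  map_restr : ∀ U W s : V, U ∈ᵥ X.opens → W ∈ᵥ X.opens → W ⊆ᵥ U → s ∈ᵥ val I U →
    val (val φ W) (restr X.res U W s) = restr M.res U W (val (val φ U) s)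

/-- `h` is the set of all maps of sheaves of modules from `I` to `M`. -/
def IsHomSet (X : RingedSpace V) (I : V) (M : ModuleSheaf V) (h : V) : Prop :=
  ∀ φ : V, φ ∈ᵥ h ↔ IsModuleMap X I M φ

/-! ### Digraphs of global generators -/

/-- `s` lies in the ideal of the ring of sections over `W` generated by the restrictions of the
elements `ρ g` for `g` in `G`. -/
def InGenerated (X : RingedSpace V) (U ρ W G s : V) : Prop :=
  s ∈ᵥ val X.car W ∧ ∀ J : V, IsIdeal (X.ring W) J →
    (∀ g : V, g ∈ᵥ G → restr X.res U W (val ρ g) ∈ᵥ J) → s ∈ᵥ J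

/-- `(N, E, r)` is a digraph of global generators on the open subspace `U`, which `(θ, ρ)` identifies
with the spectrum of `R`. It is a directed graph with set of nodes `N`, set of edges `E` and root
`r`, all of whose nodes can be reached from the root. A node is a pair `(W, G)` of a distinguished
open set `W = D(f)` and a finite subset `G` of `R`, and it stands for the ideal of `R_f`, the ring of
sections over `W`, that is generated by `G`. -/
structure IsGeneratorDigraph (X : RingedSpace V) (U : V) (R : RingData V) (θ ρ N E r : V) :
    Prop where
  node : ∀ n : V, n ∈ᵥ N → ∃ W G : V, n = pair W G ∧
    (∃ f : V, f ∈ᵥ R.car ∧ IsDistinguished U θ f W) ∧ IsFinite G ∧ G ⊆ᵥ R.car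
  edge : ∀ e : V, e ∈ᵥ E → ∃ m n : V, m ∈ᵥ N ∧ n ∈ᵥ N ∧ e = pair m n
  root_mem : r ∈ᵥ N
  reachable : ∀ A : V, r ∈ᵥ A → (∀ m n : V, m ∈ᵥ A → pair m n ∈ᵥ E → n ∈ᵥ A) → N ⊆ᵥ A
  global : ∃ G : V, r = pair U G
  functional : ∀ W G G' : V, pair W G ∈ᵥ N → pair W G' ∈ᵥ N → G = G'
  decreasing : ∀ W G W' G' : V, pair (pair W G) (pair W' G') ∈ᵥ E → W' ⊆ᵥ W ∧ W' ≠ W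
  increasing : ∀ W G W' G' : V, pair (pair W G) (pair W' G') ∈ᵥ E →
    (∀ s : V, InGenerated X U ρ W' G s → InGenerated X U ρ W' G' s) ∧
    ∃ s : V, InGenerated X U ρ W' G' s ∧ ¬ InGenerated X U ρ W' G s

/-- All generators of the digraph are sections of `I`. -/
def ContainsGenerators (X : RingedSpace V) (U ρ N I : V) : Prop :=
  ∀ W G g : V, pair W G ∈ᵥ N → g ∈ᵥ G → restr X.res U W (val ρ g) ∈ᵥ val I W

/-- The digraph with set of nodes `N` generates the restriction of `I` to `U`: this restriction is
the smallest sheaf of ideals on `U` that contains all generators. -/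
def Generates (X : RingedSpace V) (U ρ N I : V) : Prop :=
  ContainsGenerators X U ρ N I ∧ ∀ J : V, IsIdealSheafOn X U J → ContainsGenerators X U ρ N J →
    ∀ W : V, X.OpenIn U W → val I W ⊆ᵥ val J W

/-- The maps `φ` and `ψ` have the same values on all generators of the digraph. -/
def AgreeOnGenerators (X : RingedSpace V) (U ρ N φ ψ : V) : Prop :=
  ∀ W G g : V, pair W G ∈ᵥ N → g ∈ᵥ G →
    val (val φ W) (restr X.res U W (val ρ g)) = val (val ψ W) (restr X.res U W (val ρ g))

/-- `(N, E, r)` is a finite digraph of global generators on `U`, identified by `(θ, ρ)` with the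
spectrum of the Noetherian ring `R`, that generates the restriction of `I` to `U`. -/
def IsFiniteDigraphFor (X : RingedSpace V) (I U : V) (R : RingData V) (θ ρ N E r : V) : Prop :=
  IsNoetherianRing R ∧ IsAffineChart X U R θ ρ ∧ IsFinite N ∧
    IsGeneratorDigraph X U R θ ρ N E r ∧ Generates X U ρ N I

end ZFG

/-! Without power sets, the functions between two sets may form a proper class, but the finite
subsets of a set always form a set (`exists_finite_subsets`). Everything is therefore reduced to
finite data. A sheaf of ideals I on a Noetherian scheme is the smallest one containing some finite
set K of sections (`IsNoetherianScheme.exists_isGeneratedBy`). The sections on which two module maps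
agree form a sheaf of ideals (`exists_equalizer`), so maps that agree on K are equal. A map is thus
recovered from its finite table of values on K, and replacement over the finite subsets of K × ⋃
M(W) gives the set of maps. Likewise I is recovered from K, so the sheaves of ideals form a set, and
one more replacement gives the set of all sets of maps.

The core is finite generation. The sheaf I need not be quasi-coherent: I(D(f)) can be larger than
the ideal generated by I(U). On U = Spec R, each I(D(f)) is generated by its contraction to R,
because ideals of a localization are extended from R. A jump from W is some D(f) ⊆ W for which
I(D(f)) is not generated by the contraction of I(W). As R is Noetherian, finitely many jumps from W
cover all the others (`IsNoetherianRing.exists_finite_gen`, `IsJump.exists_mem_jumps`). Along a jump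
the contraction grows strictly, so the ascending chain condition excludes infinite paths
(`exists_terminal`), and a finitely branching relation without infinite paths reaches only finitely
many nodes (`exists_finite_reachable`). These nodes generate I: given a point x, take a node D(f)
containing x with no edge to another node containing x. Then no D(h) with x ∈ D(h) ⊆ D(f) is a jump,
so the generators at that node generate I(D(h)).

Two features of the theory shape the arguments. Its schemes speak of definable classes only, so
definability with parameters is carried by `DefPred` and `DefFun` and found by instance search.
Infinitely many choices are made by `least`, whose witness depends definably on the parameters;
maximal members of classes of ideals come from `exists_chain`, without ordinals. -/

set_option linter.unusedSectionVars false

namespace ZFG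

variable {V : Type u} [SetUniverse V]

/-! ### Definable predicates and functions -/

/-- A predicate on tuples that is definable with parameters. -/
class DefPred {k : ℕ} (P : (Fin k → V) → Prop) : Prop where
  out : (Set.univ : Set V).Definable setLang {v | P v}

/-- A function on tuples that is definable with parameters. -/
class DefFun {k : ℕ} (t : (Fin k → V) → V) : Prop where
  out : (Set.univ : Set V).DefinableFun setLang t

abbrev DefPred₁ (P : V → Prop) : Prop := DefPred fun v : Fin 1 → V => P (v 0)

abbrev DefPred₂ (P : V → V → Prop) : Prop := DefPred fun v : Fin 2 → V => P (v 0) (v 1)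

abbrev DefPred₃ (P : V → V → V → Prop) : Prop :=
  DefPred fun v : Fin 3 → V => P (v 0) (v 1) (v 2)

abbrev DefFun₁ (f : V → V) : Prop := DefFun fun v : Fin 1 → V => f (v 0)

abbrev DefFun₂ (f : V → V → V) : Prop := DefFun fun v : Fin 2 → V => f (v 0) (v 1)

section Closure

variable {k m : ℕ}

theorem DefPred.comp {P : (Fin m → V) → Prop} [hP : DefPred P] (t : Fin m → (Fin k → V) → V)
    (ht : ∀ i, DefFun (t i)) : DefPred fun v => P fun i => t i v :=
  ⟨Set.Definable.preimage_map (F := fun v i => t i v) (fun i => (ht i).out) hP.out⟩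

theorem DefFun.comp {f : (Fin m → V) → V} [hf : DefFun f] (t : Fin m → (Fin k → V) → V)
    (ht : ∀ i, DefFun (t i)) : DefFun fun v => f fun i => t i v :=
  ⟨Set.DefinableFun.comp (g := fun v i => t i v) (fun i => (ht i).out) hf.out⟩

theorem DefPred.comp₁ (P : V → Prop) [DefPred₁ P] (s : (Fin k → V) → V) [hs : DefFun s] :
    DefPred fun v => P (s v) :=
  DefPred.comp (P := fun v : Fin 1 → V => P (v 0)) ![s] (by simpa [Fin.forall_fin_succ] using hs)

theorem DefPred.comp₂ (P : V → V → Prop) [DefPred₂ P] (s t : (Fin k → V) → V) [hs : DefFun s]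
    [ht : DefFun t] : DefPred fun v => P (s v) (t v) :=
  DefPred.comp (P := fun v : Fin 2 → V => P (v 0) (v 1)) ![s, t]
    (by simp [Fin.forall_fin_succ, hs, ht])

theorem DefPred.comp₃ (P : V → V → V → Prop) [DefPred₃ P] (r s t : (Fin k → V) → V)
    [hr : DefFun r] [hs : DefFun s] [ht : DefFun t] : DefPred fun v => P (r v) (s v) (t v) :=
  DefPred.comp (P := fun v : Fin 3 → V => P (v 0) (v 1) (v 2)) ![r, s, t]
    (by simp [Fin.forall_fin_succ, hr, hs, ht])

theorem DefFun.comp₁ (f : V → V) [DefFun₁ f] (s : (Fin k → V) → V) [hs : DefFun s] :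
    DefFun fun v => f (s v) :=
  DefFun.comp (f := fun v : Fin 1 → V => f (v 0)) ![s] (by simpa [Fin.forall_fin_succ] using hs)

theorem DefFun.comp₂ (f : V → V → V) [DefFun₂ f] (s t : (Fin k → V) → V) [hs : DefFun s]
    [ht : DefFun t] : DefFun fun v => f (s v) (t v) :=
  DefFun.comp (f := fun v : Fin 2 → V => f (v 0) (v 1)) ![s, t]
    (by simp [Fin.forall_fin_succ, hs, ht])

variable {P Q : (Fin k → V) → Prop} {s t : (Fin k → V) → V}

theorem DefPred.congr [hP : DefPred P] (h : ∀ v, Q v ↔ P v) : DefPred Q := by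
  rwa [funext fun v => propext (h v)]

instance DefFun.var (i : Fin k) : DefFun fun v : Fin k → V => v i :=
  ⟨Set.DefinableFun.proj _⟩

instance DefFun.const (a : V) : DefFun fun _ : Fin k → V => a :=
  ⟨FirstOrder.Language.definableFun_const _ _ (Set.mem_univ a)⟩

instance DefPred.const (p : Prop) : DefPred fun _ : Fin k → V => p := by
  by_cases hp : p
  · exact ⟨by simp [hp]⟩
  · exact ⟨by simp [hp]⟩

instance DefPred.and [hP : DefPred P] [hQ : DefPred Q] : DefPred fun v => P v ∧ Q v :=
  ⟨hP.out.inter hQ.out⟩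

instance DefPred.or [hP : DefPred P] [hQ : DefPred Q] : DefPred fun v => P v ∨ Q v :=
  ⟨hP.out.union hQ.out⟩

instance DefPred.not [hP : DefPred P] : DefPred fun v => ¬ P v :=
  ⟨hP.out.compl⟩

instance DefPred.imp [DefPred P] [DefPred Q] : DefPred fun v => P v → Q v :=
  DefPred.congr (P := fun v => ¬ P v ∨ Q v) fun _ => imp_iff_not_or

instance DefPred.iff [DefPred P] [DefPred Q] : DefPred fun v => P v ↔ Q v :=
  DefPred.congr (P := fun v => (P v → Q v) ∧ (Q v → P v)) fun _ => iff_iff_implies_and_implies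

instance DefPred.eq [hs : DefFun s] [ht : DefFun t] : DefPred fun v => s v = t v :=
  ⟨hs.out.ofPred_eq ht.out⟩

theorem definable_relMap (r : setLang.Relations 2) : (Set.univ : Set V).Definable setLang
    {v : Fin 2 → V | FirstOrder.Language.Structure.RelMap r ![v 0, v 1]} := by
  refine (Set.empty_definable_iff.2 ⟨r.formula₂ (FirstOrder.Language.Term.var 0)
    (FirstOrder.Language.Term.var 1), ?_⟩).mono (Set.empty_subset _)
  ext v
  change _ ↔ FirstOrder.Language.Formula.Realize _ v
  rw [FirstOrder.Language.Formula.realize_rel₂]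
  rfl

instance DefPred.mem [DefFun s] [DefFun t] : DefPred fun v => s v ∈ᵥ t v :=
  have : DefPred₂ (SetUniverse.mem (V := V)) :=
    ⟨definable_relMap (V := V) SetSymbol.mem⟩
  DefPred.comp₂ SetUniverse.mem s t

instance DefPred.le [DefFun s] [DefFun t] : DefPred fun v => s v ≤ᵥ t v :=
  have : DefPred₂ (SetUniverse.le (V := V)) :=
    ⟨definable_relMap (V := V) SetSymbol.le⟩
  DefPred.comp₂ SetUniverse.le s t

/-- The newest bound variable has index 0 and the older ones are shifted by `Fin.succ`. An
existential quantifier is then the projection that forgets coordinate 0, and definable sets are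
closed under projections. -/
instance DefPred.ex {Q : (Fin k → V) → V → Prop}
    [h : DefPred fun v : Fin (k + 1) → V => Q (fun i => v i.succ) (v 0)] :
    DefPred fun v => ∃ x, Q v x := ⟨by
  convert h.out.image_comp Fin.succ using 1
  ext v
  constructor
  · rintro ⟨x, hx⟩
    exact ⟨Fin.cons x v, by simpa using hx, by ext i; simp⟩
  · rintro ⟨w, hw, rfl⟩
    exact ⟨w 0, hw⟩⟩

instance DefPred.all {Q : (Fin k → V) → V → Prop}
    [DefPred fun v : Fin (k + 1) → V => Q (fun i => v i.succ) (v 0)] :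
    DefPred fun v => ∀ x, Q v x :=
  DefPred.congr (P := fun v => ¬ ∃ x, ¬ Q v x) fun _ => not_exists_not.symm

instance DefPred.existsUnique {Q : (Fin k → V) → V → Prop}
    [DefPred fun v : Fin (k + 1) → V => Q (fun i => v i.succ) (v 0)] :
    DefPred fun v => ∃! x, Q v x :=
  -- The uniqueness clause binds one more variable: index 0 is now the competitor `y`, and index 1,
  -- the witness, is skipped.
  have : DefPred fun v : Fin (k + 1 + 1) → V => Q (fun i => v i.succ.succ) (v 0) :=
    DefPred.comp (P := fun v : Fin (k + 1) → V => Q (fun i => v i.succ) (v 0))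
      (Fin.cons (fun v => v 0) fun i v => v i.succ.succ)
      (Fin.cases (DefFun.var _) fun _ => DefFun.var _)
  inferInstanceAs (DefPred fun v => ∃ x, Q v x ∧ ∀ y, Q v y → y = x)

theorem DefFun.of_graph {f : (Fin k → V) → V}
    [h : DefPred fun v : Fin (k + 1) → V => v 0 = f fun i => v i.succ] : DefFun f := ⟨by
  -- The graph of a definable function has coordinates in `Option (Fin k)`, with the value at
  -- `none`.
  have := h.out.preimage_comp (Fin.cases none some : Fin (k + 1) → Option (Fin k))
  refine cast (congrArg (Set.univ.Definable setLang) (Set.ext fun v => ?_)) this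
  exact eq_comm⟩

omit [SetUniverse V] in
-- This first-order description of the graph, default case included, is what makes terms built with
-- `the` definable.
theorem the_eq_iff {P : V → Prop} {d y : V} :
    y = the P d ↔ (P y ∧ ∃! z, P z) ∨ (y = d ∧ ¬ ∃! z, P z) := by
  unfold the
  split_ifs with h
  · simp only [h, not_true_eq_false, and_false, or_false, and_true]
    exact ⟨fun e => e ▸ h.choose_spec.1, fun hy => h.unique hy h.choose_spec.1⟩
  · simp [h]

omit [SetUniverse V] in
theorem the_eq {P : V → Prop} {d y : V} (hy : P y) (h : ∀ z, P z → z = y) : the P d = y :=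
  (the_eq_iff.2 (Or.inl ⟨hy, y, hy, h⟩)).symm

omit [SetUniverse V] in
theorem the_spec {P : V → Prop} {d : V} (h : ∃! y, P y) : P (the P d) := by
  rcases the_eq_iff.1 (rfl : the P d = the P d) with h' | h'
  · exact h'.1
  · exact (h'.2 h).elim

instance DefFun.the {Q : (Fin k → V) → V → Prop} [DefFun s]
    [DefPred fun v : Fin (k + 1) → V => Q (fun i => v i.succ) (v 0)] :
    DefFun fun v => the (Q v) (s v) := by
  have : DefPred fun v : Fin (k + 1) → V => ∃! z, Q (fun i => v i.succ) z :=
    DefPred.comp (P := fun v : Fin k → V => ∃! z, Q v z) (fun i v => v i.succ)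
      fun i => DefFun.var _
  have : DefFun fun v : Fin (k + 1) → V => s fun i => v i.succ :=
    DefFun.comp (f := s) (fun i v => v i.succ) fun i => DefFun.var _
  have : DefPred fun v : Fin (k + 1) → V => v 0 = ZFG.the (Q fun i => v i.succ)
      (s fun i => v i.succ) := DefPred.congr fun _ => the_eq_iff
  exact DefFun.of_graph

instance DefPred.sub [DefFun s] [DefFun t] : DefPred fun v => s v ⊆ᵥ t v :=
  have : DefPred₂ (Sub (V := V)) := by simp only [DefPred₂, Sub]; infer_instance
  DefPred.comp₂ Sub s t

instance DefPred.isUPair {r : (Fin k → V) → V} [DefFun r] [DefFun s] [DefFun t] :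
    DefPred fun v => IsUPair (r v) (s v) (t v) :=
  have : DefPred₃ (IsUPair (V := V)) := by simp only [DefPred₃, IsUPair]; infer_instance
  DefPred.comp₃ IsUPair r s t

instance DefFun.pair [DefFun s] [DefFun t] : DefFun fun v => pair (s v) (t v) :=
  have : DefFun₂ (ZFG.pair (V := V)) := by simp only [DefFun₂, ZFG.pair]; infer_instance
  DefFun.comp₂ ZFG.pair s t

instance DefFun.val [DefFun s] [DefFun t] : DefFun fun v => val (s v) (t v) :=
  have : DefFun₂ (ZFG.val (V := V)) := by simp only [DefFun₂, ZFG.val]; infer_instance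
  DefFun.comp₂ ZFG.val s t

end Closure

end ZFG

namespace ZFG

variable {V : Type u} [SetUniverse V]

/-! ### Set-theoretic operations -/

section Operations

variable {k : ℕ}

/-- The set of the elements of `a` that satisfy `P`. -/
noncomputable def sep (P : V → Prop) (a : V) : V := the (fun b => ∀ x, x ∈ᵥ b ↔ (x ∈ᵥ a ∧ P x)) a

/-- The image of the set `a` under the operation `t`. -/
noncomputable def img (t : V → V) (a : V) : V :=
  the (fun b => ∀ y, y ∈ᵥ b ↔ ∃ x, x ∈ᵥ a ∧ y = t x) a

noncomputable def sUnion (a : V) : V := the (fun b => ∀ x, x ∈ᵥ b ↔ ∃ y, y ∈ᵥ a ∧ x ∈ᵥ y) a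

noncomputable def upair (a b : V) : V := the (fun c => ∀ x, x ∈ᵥ c ↔ (x = a ∨ x = b)) a

/-- The least `y` with `P y` in the global order. -/
noncomputable def least (P : V → Prop) (d : V) : V := the (fun y => P y ∧ ∀ z, P z → y ≤ᵥ z) d

/-- `a ∪ {x}`. -/
noncomputable def ins (a x : V) : V := the (fun b => ∀ z, z ∈ᵥ b ↔ (z ∈ᵥ a ∨ z = x)) a

noncomputable def union (a b : V) : V := sUnion (upair a b)

noncomputable def inter (a b : V) : V := sep (fun x => x ∈ᵥ b) a

/-- Products are formed by replacement and union, since cutting them out of a double power set is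
not possible here. -/
noncomputable def prod (a b : V) : V := sUnion (img (fun x => img (fun y => pair x y) b) a)

/-- The family of the values of the operation `t` on the set `a`. -/
noncomputable def fam (t : V → V) (a : V) : V := img (fun x => pair x (t x)) a

variable {s t : (Fin k → V) → V}

/-- No axiom enters: `the` returns its default where the set does not exist. The auxiliary instances
shift variables past those bound in the definition. -/
instance DefFun.sep {Q : (Fin k → V) → V → Prop} [DefFun s]
    [h : DefPred fun v : Fin (k + 1) → V => Q (fun i => v i.succ) (v 0)] :
    DefFun fun v => sep (Q v) (s v) := by
  have : DefFun fun v : Fin (k + 1) → V => s fun i => v i.succ :=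
    DefFun.comp (f := s) (fun i v => v i.succ) fun _ => DefFun.var _
  have : DefFun fun v : Fin (k + 1 + 1) → V => s fun i => v i.succ.succ :=
    DefFun.comp (f := s) (fun i v => v i.succ.succ) fun _ => DefFun.var _
  have : DefPred fun v : Fin (k + 1 + 1) → V => Q (fun i => v i.succ.succ) (v 0) :=
    DefPred.comp (P := fun v : Fin (k + 1) → V => Q (fun i => v i.succ) (v 0))
      (Fin.cons (fun v => v 0) fun i v => v i.succ.succ)
      (Fin.cases (DefFun.var _) fun _ => DefFun.var _)
  simp only [ZFG.sep]
  infer_instance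

instance DefFun.img {Q : (Fin k → V) → V → V} [DefFun s]
    [h : DefFun fun v : Fin (k + 1) → V => Q (fun i => v i.succ) (v 0)] :
    DefFun fun v => img (Q v) (s v) := by
  have : DefFun fun v : Fin (k + 1 + 1) → V => s fun i => v i.succ.succ :=
    DefFun.comp (f := s) (fun i v => v i.succ.succ) fun _ => DefFun.var _
  have : DefFun fun v : Fin (k + 1 + 1 + 1) → V => s fun i => v i.succ.succ.succ :=
    DefFun.comp (f := s) (fun i v => v i.succ.succ.succ) fun _ => DefFun.var _
  have : DefFun fun v : Fin (k + 1 + 1 + 1) → V => Q (fun i => v i.succ.succ.succ) (v 0) :=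
    DefFun.comp (f := fun v : Fin (k + 1) → V => Q (fun i => v i.succ) (v 0))
      (Fin.cons (fun v => v 0) fun i v => v i.succ.succ.succ)
      (Fin.cases (DefFun.var _) fun _ => DefFun.var _)
  simp only [ZFG.img]
  infer_instance

instance DefFun.least {Q : (Fin k → V) → V → Prop} [DefFun s]
    [h : DefPred fun v : Fin (k + 1) → V => Q (fun i => v i.succ) (v 0)] :
    DefFun fun v => least (Q v) (s v) := by
  have : DefPred fun v : Fin (k + 1 + 1) → V => Q (fun i => v i.succ.succ) (v 0) :=
    DefPred.comp (P := fun v : Fin (k + 1) → V => Q (fun i => v i.succ) (v 0))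
      (Fin.cons (fun v => v 0) fun i v => v i.succ.succ)
      (Fin.cases (DefFun.var _) fun _ => DefFun.var _)
  simp only [ZFG.least]
  infer_instance

instance DefFun.sUnion [DefFun s] : DefFun fun v => sUnion (s v) :=
  have : DefFun₁ (ZFG.sUnion (V := V)) := by simp only [DefFun₁, ZFG.sUnion]; infer_instance
  DefFun.comp₁ ZFG.sUnion s

instance DefFun.upair [DefFun s] [DefFun t] : DefFun fun v => upair (s v) (t v) :=
  have : DefFun₂ (ZFG.upair (V := V)) := by simp only [DefFun₂, ZFG.upair]; infer_instance
  DefFun.comp₂ ZFG.upair s t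

instance DefFun.ins [DefFun s] [DefFun t] : DefFun fun v => ins (s v) (t v) :=
  have : DefFun₂ (ZFG.ins (V := V)) := by simp only [DefFun₂, ZFG.ins]; infer_instance
  DefFun.comp₂ ZFG.ins s t

instance DefFun.union [DefFun s] [DefFun t] : DefFun fun v => union (s v) (t v) :=
  have : DefFun₂ (ZFG.union (V := V)) := by simp only [DefFun₂, ZFG.union]; infer_instance
  DefFun.comp₂ ZFG.union s t

instance DefFun.inter [DefFun s] [DefFun t] : DefFun fun v => inter (s v) (t v) :=
  have : DefFun₂ (ZFG.inter (V := V)) := by simp only [DefFun₂, ZFG.inter]; infer_instance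
  DefFun.comp₂ ZFG.inter s t

end Operations

/-! ### Consequences of the axioms for sets, pairs and functions -/

section Axioms

variable [hV : Fact (IsModelZFG0 V)]

theorem set_ext {a b : V} (h : ∀ x, x ∈ᵥ a ↔ x ∈ᵥ b) : a = b := hV.out.extensionality a b h

theorem Sub.antisymm {a b : V} (h : a ⊆ᵥ b) (h' : b ⊆ᵥ a) : a = b :=
  set_ext fun x => ⟨h x, h' x⟩

/-- The set with a given extension, if it exists. -/
theorem mem_the {P : V → Prop} {d : V} (h : ∃ b, ∀ x, x ∈ᵥ b ↔ P x) (x : V) :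
    x ∈ᵥ the (fun b => ∀ x, x ∈ᵥ b ↔ P x) d ↔ P x :=
  the_spec (P := fun b => ∀ x, x ∈ᵥ b ↔ P x)
    (h.imp fun _ hb => ⟨hb, fun _ hc => set_ext fun x => (hc x).trans (hb x).symm⟩) x

@[simp] theorem mem_sep {P : V → Prop} [h : DefPred₁ P] {a x : V} :
    x ∈ᵥ sep P a ↔ x ∈ᵥ a ∧ P x :=
  mem_the (hV.out.separation {x | P x} h.out a) x

/-- Replacement for partial functional relations: the axiom wants a value at every element, so the
domain is first cut out by separation. -/
theorem exists_rel_image {F : V → V → Prop} [h : DefPred₂ F] (a : V)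
    (hF : ∀ x y z, x ∈ᵥ a → F x y → F x z → y = z) :
    ∃ b : V, ∀ y, y ∈ᵥ b ↔ ∃ x, x ∈ᵥ a ∧ F x y := by
  have h₁ : DefPred₁ fun x => ∃ y, F x y :=
    have : DefPred fun v : Fin 2 → V => F (v (Fin.succ 0)) (v 0) :=
      DefPred.comp₂ F (fun v => v (Fin.succ 0)) (fun v => v 0)
    inferInstance
  obtain ⟨b, hb⟩ := hV.out.replacement {p | F p.1 p.2} h.out (sep (fun x => ∃ y, F x y) a)
    fun x hx => by
      obtain ⟨hx, y, hy⟩ := mem_sep.1 hx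
      exact ⟨y, hy, fun z hz => hF x z y hx hz hy⟩
  refine ⟨b, fun y => (hb y).trans ?_⟩
  simp only [mem_sep, Set.mem_ofPred_eq]
  exact ⟨fun ⟨x, hx, hxy⟩ => ⟨x, hx.1, hxy⟩, fun ⟨x, hx, hxy⟩ => ⟨x, ⟨hx, y, hxy⟩, hxy⟩⟩

@[simp] theorem mem_img {t : V → V} [h : DefFun₁ t] {a y : V} :
    y ∈ᵥ img t a ↔ ∃ x, x ∈ᵥ a ∧ y = t x := by
  have : DefPred₂ fun x y => y = t x :=
    have : DefFun fun v : Fin 2 → V => t (v 0) := DefFun.comp₁ t _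
    inferInstance
  exact mem_the (exists_rel_image a fun x y z _ hy hz => hy.trans hz.symm) y

@[simp] theorem mem_sUnion {a x : V} : x ∈ᵥ sUnion a ↔ ∃ y, y ∈ᵥ a ∧ x ∈ᵥ y :=
  mem_the (hV.out.union a) x

@[simp] theorem mem_upair {a b x : V} : x ∈ᵥ upair a b ↔ x = a ∨ x = b :=
  mem_the (hV.out.pairing a b) x

@[simp] theorem mem_union {a b x : V} : x ∈ᵥ union a b ↔ x ∈ᵥ a ∨ x ∈ᵥ b := by
  simp [union]

@[simp] theorem mem_inter {a b x : V} : x ∈ᵥ inter a b ↔ x ∈ᵥ a ∧ x ∈ᵥ b := by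
  simp [inter]

@[simp] theorem mem_ins {a x z : V} : z ∈ᵥ ins a x ↔ z ∈ᵥ a ∨ z = x :=
  mem_the ⟨union a (upair x x), by simp⟩ z

/-- This is the form of choice used throughout. The chosen witness depends definably on parameters,
so replacement applies to it. -/
theorem least_spec {P : V → Prop} [h : DefPred₁ P] {d : V} (hP : ∃ x, P x) : P (least P d) := by
  obtain ⟨x, hx, hx'⟩ := hV.out.exists_least {x | P x} h.out hP
  exact (the_spec (P := fun y => P y ∧ ∀ z, P z → y ≤ᵥ z)
    ⟨x, ⟨hx, hx'⟩, fun y hy => hV.out.le_antisymm _ _ (hy.2 x hx) (hx' y hy.1)⟩).1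

variable (V) in
theorem exists_empty : ∃ e : V, ∀ x, ¬ x ∈ᵥ e := by
  obtain ⟨w, ⟨e, -, he⟩, -⟩ := hV.out.infinity
  exact ⟨e, he⟩

variable (V) in
noncomputable def emp : V := (exists_empty V).choose

@[simp] theorem notMem_emp {x : V} : ¬ x ∈ᵥ emp V := (exists_empty V).choose_spec x

theorem eq_emp {a : V} (h : ∀ x, ¬ x ∈ᵥ a) : a = emp V := set_ext fun x => by simp [h x]

theorem mem_asymm {a b : V} (h : a ∈ᵥ b) : ¬ b ∈ᵥ a := by
  intro h'
  obtain ⟨x, hx, hx'⟩ := hV.out.foundation (upair a b) ⟨a, by simp⟩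
  rcases mem_upair.1 hx with rfl | rfl
  · exact hx' b ⟨by simp, h'⟩
  · exact hx' a ⟨by simp, h⟩

theorem mem_irrefl (a : V) : ¬ a ∈ᵥ a := fun h => mem_asymm h h

theorem isUPair_iff {z x y : V} : IsUPair z x y ↔ z = upair x y :=
  ⟨fun h => set_ext fun w => by rw [h w, mem_upair], fun h w => by rw [h, mem_upair]⟩

theorem pair_eq {x y : V} : pair x y = upair (upair x x) (upair x y) :=
  the_eq (fun z => by simp [isUPair_iff]) fun z hz => set_ext fun w => by simp [hz w, isUPair_iff]

theorem upair_eq_upair {a b c d : V} (h : upair a b = upair c d) :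
    (a = c ∧ b = d) ∨ (a = d ∧ b = c) := by
  have h' : ∀ x, (x = a ∨ x = b) ↔ (x = c ∨ x = d) := fun x => by
    rw [← mem_upair, h, mem_upair]
  have h₁ := h' a
  have h₂ := h' b
  have h₃ := h' c
  have h₄ := h' d
  grind

@[simp] theorem pair_inj {x y z w : V} : pair x y = pair z w ↔ x = z ∧ y = w := by
  refine ⟨fun h => ?_, by rintro ⟨rfl, rfl⟩; rfl⟩
  rw [pair_eq, pair_eq] at h
  rcases upair_eq_upair h with ⟨h₁, h₂⟩ | ⟨h₁, h₂⟩
  · have := upair_eq_upair h₁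
    have := upair_eq_upair h₂
    grind
  · have := upair_eq_upair h₁
    have := upair_eq_upair h₂
    grind

@[simp] theorem mem_prod {a b p : V} :
    p ∈ᵥ prod a b ↔ ∃ x y, x ∈ᵥ a ∧ y ∈ᵥ b ∧ p = pair x y := by
  simp only [prod, mem_sUnion, mem_img]
  constructor
  · rintro ⟨_, ⟨x, hx, rfl⟩, h⟩
    obtain ⟨y, hy, rfl⟩ := mem_img.1 h
    exact ⟨x, y, hx, hy, rfl⟩
  · rintro ⟨x, y, hx, hy, rfl⟩
    exact ⟨_, ⟨x, hx, rfl⟩, mem_img.2 ⟨y, hy, rfl⟩⟩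

/-! ### Functions and families -/

theorem IsFamily.pair_mem {f : V} {D : V → Prop} (h : IsFamily f D) {x : V} (hx : D x) :
    pair x (val f x) ∈ᵥ f :=
  the_spec (P := fun y => pair x y ∈ᵥ f) (h.2 x hx)

theorem IsFamily.val_eq {f : V} {D : V → Prop} (h : IsFamily f D) {x y : V} (hx : D x)
    (hy : pair x y ∈ᵥ f) : val f x = y :=
  (h.2 x hx).unique (h.pair_mem hx) hy

theorem IsFamily.ext {f g : V} {D : V → Prop} (hf : IsFamily f D) (hg : IsFamily g D)
    (h : ∀ x, D x → val f x = val g x) : f = g := by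
  refine set_ext fun p => ⟨fun hp => ?_, fun hp => ?_⟩
  · obtain ⟨x, y, hx, rfl⟩ := hf.1 p hp
    rw [← hf.val_eq hx hp, h x hx]
    exact hg.pair_mem hx
  · obtain ⟨x, y, hx, rfl⟩ := hg.1 p hp
    rw [← hg.val_eq hx hp, ← h x hx]
    exact hf.pair_mem hx

theorem IsFun.isFamily {f A B : V} (h : IsFun f A B) : IsFamily f (fun x => x ∈ᵥ A) :=
  ⟨fun p hp => by obtain ⟨x, y, hx, -, rfl⟩ := h.1 p hp; exact ⟨x, y, hx, rfl⟩, h.2⟩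

theorem IsFun.val_mem {f A B x : V} (h : IsFun f A B) (hx : x ∈ᵥ A) : val f x ∈ᵥ B := by
  obtain ⟨x', y', -, hy, e⟩ := h.1 _ (h.isFamily.pair_mem hx)
  rw [pair_inj] at e
  exact e.2 ▸ hy

theorem IsFun.ext {f g A B C : V} (hf : IsFun f A B) (hg : IsFun g A C)
    (h : ∀ x, x ∈ᵥ A → val f x = val g x) : f = g :=
  hf.isFamily.ext hg.isFamily h

theorem IsFun₂.val_mem {f A B C x y : V} (h : IsFun₂ f A B C) (hx : x ∈ᵥ A) (hy : y ∈ᵥ B) :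
    val₂ f x y ∈ᵥ C := by
  have := the_spec (P := fun z => pair (pair x y) z ∈ᵥ f) (d := pair x y) (h.2 x y hx hy)
  obtain ⟨x', y', z, -, -, hz, e⟩ := h.1 _ this
  rw [pair_inj] at e
  exact (show val₂ f x y = z from e.2) ▸ hz

theorem isFamily_fam (t : V → V) [DefFun₁ t] (a : V) : IsFamily (fam t a) (fun x => x ∈ᵥ a) := by
  have : DefFun₁ fun x => pair x (t x) := inferInstance
  refine ⟨fun p hp => ?_, fun x hx => ⟨t x, mem_img.2 ⟨x, hx, rfl⟩, fun y hy => ?_⟩⟩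
  · obtain ⟨x, hx, rfl⟩ := mem_img.1 hp
    exact ⟨x, t x, hx, rfl⟩
  · obtain ⟨x', -, e⟩ := mem_img.1 hy
    rw [pair_inj] at e
    rw [e.2, e.1]

theorem val_fam {t : V → V} [DefFun₁ t] {a x : V} (hx : x ∈ᵥ a) : val (fam t a) x = t x :=
  (isFamily_fam t a).val_eq hx (mem_img.2 ⟨x, hx, rfl⟩)

theorem Sub.refl (a : V) : a ⊆ᵥ a := fun _ h => h

theorem Sub.trans {a b c : V} (h : a ⊆ᵥ b) (h' : b ⊆ᵥ c) : a ⊆ᵥ c := fun x hx => h' x (h x hx)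

end Axioms

end ZFG

namespace ZFG

variable {V : Type u} [SetUniverse V]

section Definability

variable {k : ℕ} {r s t : (Fin k → V) → V}

instance DefPred.isInductive [DefFun s] : DefPred fun v => IsInductive (s v) :=
  have : DefPred₁ (IsInductive (V := V)) := by
    simp only [DefPred₁, IsInductive]; infer_instance
  DefPred.comp₁ IsInductive s

instance DefPred.isNat [DefFun s] : DefPred fun v => IsNat (s v) :=
  have : DefPred₁ (IsNat (V := V)) := by
    simp only [DefPred₁, IsNat]; infer_instance
  DefPred.comp₁ IsNat s

instance DefPred.isFun [DefFun r] [DefFun s] [DefFun t] :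
    DefPred fun v => IsFun (r v) (s v) (t v) :=
  have : DefPred₃ (IsFun (V := V)) := by
    simp only [DefPred₃, IsFun]; infer_instance
  DefPred.comp₃ IsFun r s t

/-- `f` is a bijection from `n` to `A`. -/
def IsBij (n f A : V) : Prop :=
  IsFun f n A ∧ ∀ y : V, y ∈ᵥ A → ∃! x : V, x ∈ᵥ n ∧ pair x y ∈ᵥ f

instance DefPred.isBij [DefFun r] [DefFun s] [DefFun t] :
    DefPred fun v => IsBij (r v) (s v) (t v) :=
  have : DefPred₃ (IsBij (V := V)) := by
    simp only [DefPred₃, IsBij]; infer_instance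
  DefPred.comp₃ IsBij r s t

instance DefPred.isFinite [DefFun s] : DefPred fun v => IsFinite (s v) :=
  have : DefPred₁ (IsFinite (V := V)) := by
    simp only [DefPred₁, IsFinite]; infer_instance
  DefPred.comp₁ IsFinite s

end Definability

variable [hV : Fact (IsModelZFG0 V)]

/-! ### Natural numbers -/

theorem isInductive_iff {w : V} :
    IsInductive w ↔ emp V ∈ᵥ w ∧ ∀ x, x ∈ᵥ w → ins x x ∈ᵥ w := by
  refine and_congr ⟨?_, fun h => ⟨_, h, fun _ => notMem_emp⟩⟩
    (forall₂_congr fun x hx => ⟨?_, fun h => ⟨_, h, fun _ => mem_ins⟩⟩)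
  · rintro ⟨e, he, h⟩
    exact eq_emp h ▸ he
  · rintro ⟨s, hs, h⟩
    exact (show s = ins x x from set_ext fun z => by rw [h, mem_ins]) ▸ hs

variable (V) in
theorem exists_omega : ∃ w : V, ∀ n, n ∈ᵥ w ↔ IsNat n := by
  obtain ⟨w, hw⟩ := hV.out.infinity
  exact ⟨sep IsNat w, fun n => mem_sep.trans ⟨fun h => h.2, fun h => ⟨h w hw, h⟩⟩⟩

variable (V) in
/-- The set of natural numbers. -/
noncomputable def omega : V := (exists_omega V).choose

@[simp] theorem mem_omega {n : V} : n ∈ᵥ omega V ↔ IsNat n := (exists_omega V).choose_spec n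

theorem isNat_emp : IsNat (emp V) := fun _ hw => (isInductive_iff.1 hw).1

theorem IsNat.succ {n : V} (h : IsNat n) : IsNat (ins n n) :=
  fun w hw => (isInductive_iff.1 hw).2 n (h w hw)

theorem IsNat.induction {P : V → Prop} [DefPred₁ P] (h₀ : P (emp V))
    (h₁ : ∀ n, IsNat n → P n → P (ins n n)) {n : V} (hn : IsNat n) : P n := by
  have : IsInductive (sep P (omega V)) := by
    simp only [isInductive_iff, mem_sep, mem_omega]
    exact ⟨⟨isNat_emp, h₀⟩, fun n hn => ⟨hn.1.succ, h₁ n hn.1 hn.2⟩⟩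
  exact (mem_sep.1 (hn _ this)).2

/-! ### Finite sets -/

theorem IsBij.isFinite {n f A : V} (hn : IsNat n) (h : IsBij n f A) : IsFinite A :=
  ⟨n, f, hn, h⟩

theorem IsBij.emp {f A : V} (h : IsBij (emp V) f A) : A = emp V :=
  eq_emp fun y hy => by
    obtain ⟨x, hx, -⟩ := h.2 y hy
    exact notMem_emp hx.1

/-- Foundation gives n ∉ n, so n is a fresh index at which the new element can be placed. -/
theorem IsBij.ins {n f A x : V} (h : IsBij n f A) (hx : ¬ x ∈ᵥ A) :
    IsBij (ins n n) (ins f (pair n x)) (ins A x) := by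
  have h' : ∀ y z, pair y z ∈ᵥ f → y ∈ᵥ n ∧ z ∈ᵥ A := fun y z hyz => by
    obtain ⟨y', z', hy, hz, e⟩ := h.1.1 _ hyz
    rw [pair_inj] at e
    exact ⟨e.1 ▸ hy, e.2 ▸ hz⟩
  have hn := mem_irrefl n
  refine ⟨⟨fun p hp => ?_, fun y hy => ?_⟩, fun y hy => ?_⟩
  · rcases mem_ins.1 hp with hp | rfl
    · obtain ⟨y, z, hy, hz, rfl⟩ := h.1.1 p hp
      exact ⟨y, z, by simp [hy], by simp [hz], rfl⟩
    · exact ⟨n, x, by simp, by simp, rfl⟩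
  · simp only [mem_ins, pair_inj] at hy ⊢
    rcases hy with hy | rfl
    · obtain ⟨z, hz, hz'⟩ := h.1.2 y hy
      refine ⟨z, Or.inl hz, ?_⟩
      rintro w (hw | ⟨rfl, rfl⟩)
      · exact hz' w hw
      · exact (hn hy).elim
    · refine ⟨x, Or.inr ⟨rfl, rfl⟩, ?_⟩
      rintro w (hw | ⟨-, rfl⟩)
      · exact (hn (h' _ _ hw).1).elim
      · rfl
  · simp only [mem_ins, pair_inj] at hy ⊢
    rcases hy with hy | rfl
    · obtain ⟨z, hz, hz'⟩ := h.2 y hy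
      refine ⟨z, ⟨Or.inl hz.1, Or.inl hz.2⟩, ?_⟩
      rintro w ⟨-, hw | ⟨rfl, rfl⟩⟩
      · exact hz' w ⟨(h' _ _ hw).1, hw⟩
      · exact (hx hy).elim
    · refine ⟨n, ⟨Or.inr rfl, Or.inr ⟨rfl, rfl⟩⟩, ?_⟩
      rintro w ⟨-, hw | ⟨rfl, -⟩⟩
      · exact (hx (h' _ _ hw).2).elim
      · rfl

/-- The element removed is the value at the last index n; injectivity keeps the remaining values
away from it. -/
theorem IsBij.exists_eq_ins {n f A : V} (h : IsBij (ZFG.ins n n) f A) :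
    ∃ B g x, ¬ x ∈ᵥ B ∧ A = ZFG.ins B x ∧ IsBij n g B := by
  have hn : n ∈ᵥ ZFG.ins n n := by simp
  have hnn := mem_irrefl n
  have hp := h.1.isFamily.pair_mem hn
  have hx := h.1.val_mem hn
  have hval : ∀ y z, pair y z ∈ᵥ f → y ∈ᵥ ZFG.ins n n ∧ z ∈ᵥ A := fun y z hyz => by
    obtain ⟨y', z', hy, hz, e⟩ := h.1.1 _ hyz
    rw [pair_inj] at e
    exact ⟨e.1 ▸ hy, e.2 ▸ hz⟩
  have hinj : ∀ y, pair y (val f n) ∈ᵥ f → y = n := fun y hy =>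
    (h.2 _ hx).unique ⟨(hval _ _ hy).1, hy⟩ ⟨hn, hp⟩
  refine ⟨sep (fun y => y ≠ val f n) A, sep (fun p => ¬ ∃ y, p = pair n y) f, val f n,
    by simp, set_ext fun y => ?_, ⟨fun p hp => ?_, fun y hy => ?_⟩, fun y hy => ?_⟩
  · simp only [mem_ins, mem_sep]
    by_cases hy : y = val f n <;> simp [hy, hx]
  · simp only [mem_sep] at hp ⊢
    obtain ⟨y, z, hy, hz, rfl⟩ := h.1.1 p hp.1
    have hyn : y ≠ n := fun e => hp.2 ⟨z, by rw [e]⟩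
    refine ⟨y, z, (mem_ins.1 hy).resolve_right hyn, ⟨hz, ?_⟩, rfl⟩
    rintro rfl
    exact hyn (hinj y hp.1)
  · obtain ⟨z, hz, hz'⟩ := h.1.2 y (mem_ins.2 (Or.inl hy))
    refine ⟨z, mem_sep.2 ⟨hz, ?_⟩, fun w hw => hz' w (mem_sep.1 hw).1⟩
    rintro ⟨w, hw⟩
    rw [pair_inj] at hw
    exact hnn (hw.1 ▸ hy)
  · obtain ⟨hy, hne⟩ := mem_sep.1 hy
    obtain ⟨z, hz, hz'⟩ := h.2 y hy
    have hzn : z ≠ n := by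
      rintro rfl
      exact hne (h.1.isFamily.val_eq hn hz.2).symm
    refine ⟨z, ⟨(mem_ins.1 hz.1).resolve_right hzn, mem_sep.2 ⟨hz.2, ?_⟩⟩, ?_⟩
    · rintro ⟨w, hw⟩
      rw [pair_inj] at hw
      exact hzn hw.1
    · rintro w ⟨hw, hw'⟩
      exact hz' w ⟨mem_ins.2 (Or.inl hw), (mem_sep.1 hw').1⟩

theorem isFinite_emp : IsFinite (emp V) :=
  ⟨emp V, emp V, isNat_emp, ⟨fun _ hp => (notMem_emp hp).elim, fun _ hp => (notMem_emp hp).elim⟩,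
    fun _ hp => (notMem_emp hp).elim⟩

theorem ins_eq_self {A x : V} (h : x ∈ᵥ A) : ins A x = A :=
  set_ext fun z => by simp only [mem_ins, or_iff_left_iff_imp]; rintro rfl; exact h

theorem IsFinite.ins {A : V} (h : IsFinite A) (x : V) : IsFinite (ins A x) := by
  by_cases hx : x ∈ᵥ A
  · rwa [ins_eq_self hx]
  · obtain ⟨n, f, hn, hf⟩ := h
    exact ⟨_, _, hn.succ, IsBij.ins hf hx⟩

theorem IsFinite.induction {Q : V → Prop} [DefPred₁ Q] (h₀ : Q (emp V))
    (h₁ : ∀ A x, IsFinite A → Q A → Q (ZFG.ins A x)) {A : V} (hA : IsFinite A) : Q A := by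
  obtain ⟨n, f, hn, hf⟩ := hA
  -- Under the quantifiers over `A` and `f` in the induction predicate, `A` has index 1.
  have : DefPred fun v : Fin 3 → V => Q (v (Fin.succ 0)) := DefPred.comp₁ Q _
  refine IsNat.induction (P := fun n => ∀ A f, IsBij n f A → Q A) ?_ ?_ hn A f hf
  · intro A f h
    rwa [h.emp]
  · intro n hn ih A f h
    obtain ⟨B, g, x, -, rfl, hg⟩ := h.exists_eq_ins
    exact h₁ B x (hg.isFinite hn) (ih B g hg)

theorem img_emp (t : V → V) [DefFun₁ t] : img t (emp V) = emp V := eq_emp fun x => by simp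

theorem img_ins (t : V → V) [DefFun₁ t] (A x : V) : img t (ins A x) = ins (img t A) (t x) :=
  set_ext fun y => by
    simp only [mem_img, mem_ins, or_and_right, exists_or, exists_eq_left]

theorem IsFinite.img {A : V} (h : IsFinite A) (t : V → V) [DefFun₁ t] : IsFinite (img t A) := by
  have : DefFun fun v : Fin 2 → V => t (v 0) := DefFun.comp₁ t _
  refine IsFinite.induction (Q := fun A => IsFinite (ZFG.img t A)) ?_ (fun A x _ ih => ?_) h
  · rw [img_emp]
    exact isFinite_emp
  · rw [img_ins]
    exact ih.ins _

theorem IsFinite.union {A B : V} (hA : IsFinite A) (hB : IsFinite B) : IsFinite (union A B) := by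
  refine IsFinite.induction (Q := fun B => IsFinite (ZFG.union A B)) ?_ (fun B x _ ih => ?_) hB
  · rwa [show ZFG.union A (emp V) = A from set_ext fun x => by simp]
  · rw [show ZFG.union A (ZFG.ins B x) = ZFG.ins (ZFG.union A B) x from
      set_ext fun z => by simp only [mem_union, mem_ins, or_assoc]]
    exact ih.ins _

theorem IsFinite.sUnion {A : V} (hA : IsFinite A) (h : ∀ B, B ∈ᵥ A → IsFinite B) :
    IsFinite (sUnion A) := by
  refine IsFinite.induction (Q := fun A => (∀ B, B ∈ᵥ A → IsFinite B) → IsFinite (ZFG.sUnion A))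
    (fun _ => ?_) (fun A x _ ih h => ?_) hA h
  · rw [show ZFG.sUnion (emp V) = emp V from eq_emp fun x => by simp]
    exact isFinite_emp
  · rw [show ZFG.sUnion (ZFG.ins A x) = ZFG.union (ZFG.sUnion A) x from set_ext fun z => by
      simp only [mem_sUnion, mem_ins, mem_union, or_and_right, exists_or, exists_eq_left]]
    exact (ih fun B hB => h B (mem_ins.2 (Or.inl hB))).union (h x (mem_ins.2 (Or.inr rfl)))

/-- This stands in for the power set axiom. A subset with n + 1 elements is a subset with n elements
and one more point, so a set containing all subsets of size n yields one for size n + 1. -/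
theorem exists_finite_subsets (A : V) : ∃ S : V, ∀ B, B ∈ᵥ S ↔ (IsFinite B ∧ B ⊆ᵥ A) := by
  have h : ∀ n, IsNat n → ∃ S, ∀ B f, B ⊆ᵥ A → IsBij n f B → B ∈ᵥ S := fun n hn => by
    refine IsNat.induction (P := fun n => ∃ S, ∀ B f, B ⊆ᵥ A → IsBij n f B → B ∈ᵥ S) ?_ ?_ hn
    · exact ⟨upair (emp V) (emp V), fun B f _ hf => by simp [hf.emp]⟩
    · rintro n - ⟨S, hS⟩
      refine ⟨ZFG.sUnion (ZFG.img (fun B => ZFG.img (fun x => ZFG.ins B x) A) S),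
        fun B f hB hf => ?_⟩
      obtain ⟨C, g, x, -, rfl, hg⟩ := hf.exists_eq_ins
      simp only [mem_sUnion, mem_img]
      exact ⟨_, ⟨C, hS C g (fun z hz => hB z (mem_ins.2 (Or.inl hz))) hg, rfl⟩,
        mem_img.2 ⟨x, hB x (mem_ins.2 (Or.inr rfl)), rfl⟩⟩
  -- The sets provided by `h` are not unique, so one is selected for each n before replacement over
  -- ω. They may have superfluous members, which the separation below removes.
  let t : V → V := fun n => least (fun S => ∀ B f, B ⊆ᵥ A → IsBij n f B → B ∈ᵥ S) n
  have ht : DefFun₁ t := inferInstance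
  refine ⟨sep (fun B => IsFinite B ∧ B ⊆ᵥ A) (ZFG.sUnion (ZFG.img t (omega V))), fun B => ?_⟩
  rw [mem_sep, and_iff_right_iff_imp]
  rintro ⟨⟨n, f, hn, hf⟩, hB⟩
  rw [mem_sUnion]
  exact ⟨t n, mem_img.2 ⟨n, mem_omega.2 hn, rfl⟩, least_spec
    (P := fun S => ∀ B f, B ⊆ᵥ A → IsBij n f B → B ∈ᵥ S) (h n hn) B f hB hf⟩

/-- The set of the finite subsets of `A`. -/
noncomputable def finSub (A : V) : V := (exists_finite_subsets A).choose

@[simp] theorem mem_finSub {A B : V} : B ∈ᵥ finSub A ↔ IsFinite B ∧ B ⊆ᵥ A :=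
  (exists_finite_subsets A).choose_spec B

end ZFG

namespace ZFG

variable {V : Type u} [SetUniverse V]

/-! ### Definability of the notions of ring and sheaf theory -/

section Definability

variable {k : ℕ} {s t r : (Fin k → V) → V}

/-- A definable family of ring data. -/
class DefRing {k : ℕ} (R : (Fin k → V) → RingData V) : Prop where
  car : DefFun fun v => (R v).car
  add : DefFun fun v => (R v).add
  mul : DefFun fun v => (R v).mul
  zero : DefFun fun v => (R v).zero
  one : DefFun fun v => (R v).one

attribute [instance] DefRing.car DefRing.add DefRing.mul DefRing.zero DefRing.one

instance DefFun.val₂ [DefFun r] [DefFun s] [DefFun t] : DefFun fun v => val₂ (r v) (s v) (t v) := by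
  simp only [ZFG.val₂]; infer_instance

instance DefFun.restr {q : (Fin k → V) → V} [DefFun q] [DefFun r] [DefFun s] [DefFun t] :
    DefFun fun v => restr (q v) (r v) (s v) (t v) := by
  simp only [ZFG.restr]; infer_instance

instance DefRing.const (R : RingData V) : DefRing fun _ : Fin k → V => R where
  car := inferInstance
  add := inferInstance
  mul := inferInstance
  zero := inferInstance
  one := inferInstance

instance DefRing.mk' {a b c d e : (Fin k → V) → V} [DefFun a] [DefFun b] [DefFun c] [DefFun d]
    [DefFun e] : DefRing fun v => (⟨a v, b v, c v, d v, e v⟩ : RingData V) where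
  car := inferInstance
  add := inferInstance
  mul := inferInstance
  zero := inferInstance
  one := inferInstance

instance DefRing.ring (X : RingedSpace V) [DefFun s] : DefRing fun v => X.ring (s v) :=
  inferInstanceAs (DefRing fun v =>
    (⟨val X.car (s v), val X.add (s v), val X.mul (s v), val X.zero (s v), val X.one (s v)⟩ :
      RingData V))

variable {R : (Fin k → V) → RingData V}

instance DefFun.plus [DefRing R] [DefFun s] [DefFun t] : DefFun fun v => (R v).plus (s v) (t v) := by
  simp only [RingData.plus]; infer_instance

instance DefFun.times [DefRing R] [DefFun s] [DefFun t] :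
    DefFun fun v => (R v).times (s v) (t v) := by
  simp only [RingData.times]; infer_instance

instance DefFun.modulePlus (M : ModuleSheaf V) [DefFun r] [DefFun s] [DefFun t] :
    DefFun fun v => M.plus (r v) (s v) (t v) := by
  simp only [ModuleSheaf.plus]; infer_instance

instance DefFun.moduleAct (M : ModuleSheaf V) [DefFun r] [DefFun s] [DefFun t] :
    DefFun fun v => M.act (r v) (s v) (t v) := by
  simp only [ModuleSheaf.act]; infer_instance

/-- Structures are unfolded into conjunctions because the definability instances follow the logical
connectives. -/
theorem isIdeal_iff {R : RingData V} {J : V} : IsIdeal R J ↔ J ⊆ᵥ R.car ∧ R.zero ∈ᵥ J ∧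
    (∀ x y : V, x ∈ᵥ J → y ∈ᵥ J → R.plus x y ∈ᵥ J) ∧
    ∀ a x : V, a ∈ᵥ R.car → x ∈ᵥ J → R.times a x ∈ᵥ J :=
  ⟨fun h => ⟨h.1, h.2, h.3, h.4⟩, fun h => ⟨h.1, h.2.1, h.2.2.1, h.2.2.2⟩⟩

instance DefPred.isIdeal [DefRing R] [DefFun s] : DefPred fun v => IsIdeal (R v) (s v) := by
  -- A ring varying with parameters is a tuple of five sets, so the predicate is treated as one of
  -- six variables.
  have : DefPred fun v : Fin 6 → V => IsIdeal ⟨v 0, v 1, v 2, v 3, v 4⟩ (v 5) := by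
    simp only [isIdeal_iff]; infer_instance
  refine DefPred.comp (P := fun v : Fin 6 → V => IsIdeal ⟨v 0, v 1, v 2, v 3, v 4⟩ (v 5))
    ![fun v => (R v).car, fun v => (R v).add, fun v => (R v).mul, fun v => (R v).zero,
      fun v => (R v).one, s] ?_
  simp only [Fin.forall_fin_succ, IsEmpty.forall_iff, and_true]
  exact ⟨DefRing.car, DefRing.add, DefRing.mul, DefRing.zero, DefRing.one, ‹DefFun s›⟩

instance DefPred.openIn (X : RingedSpace V) [DefFun s] [DefFun t] :
    DefPred fun v => X.OpenIn (s v) (t v) := by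
  simp only [RingedSpace.OpenIn]; infer_instance

instance DefPred.isFamily {D : (Fin k → V) → V → Prop} [DefFun s]
    [DefPred fun v : Fin (k + 1) → V => D (fun i => v i.succ) (v 0)] :
    DefPred fun v => IsFamily (s v) (D v) := by
  have : DefPred fun v : Fin (k + 1 + 1 + 1) → V => D (fun i => v i.succ.succ.succ) (v (Fin.succ 0)) :=
    DefPred.comp (P := fun v : Fin (k + 1) → V => D (fun i => v i.succ) (v 0))
      (Fin.cons (fun v => v (Fin.succ 0)) fun i v => v i.succ.succ.succ)
      (Fin.cases (DefFun.var _) fun _ => DefFun.var _)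
  have : DefFun fun v : Fin (k + 1) → V => s fun i => v i.succ :=
    DefFun.comp (f := s) (fun i v => v i.succ) fun _ => DefFun.var _
  have : DefFun fun v : Fin (k + 1 + 1) → V => s fun i => v i.succ.succ :=
    DefFun.comp (f := s) (fun i v => v i.succ.succ) fun _ => DefFun.var _
  simp only [IsFamily]; infer_instance

theorem isSheaf_iff {Op : V → Prop} {F res : V} : IsSheaf Op F res ↔
    (∀ U W s : V, Op U → Op W → W ⊆ᵥ U → s ∈ᵥ val F U → restr res U W s ∈ᵥ val F W) ∧
    (∀ U s : V, Op U → s ∈ᵥ val F U → restr res U U s = s) ∧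
    (∀ U W N s : V, Op U → Op W → Op N → W ⊆ᵥ U → N ⊆ᵥ W → s ∈ᵥ val F U →
      restr res W N (restr res U W s) = restr res U N s) ∧
    (∀ U S s t : V, Op U → IsCover Op U S → s ∈ᵥ val F U → t ∈ᵥ val F U →
      (∀ W : V, W ∈ᵥ S → restr res U W s = restr res U W t) → s = t) ∧
    (∀ U S c : V, Op U → IsCover Op U S → IsFamily c (fun W => W ∈ᵥ S) →
      (∀ W : V, W ∈ᵥ S → val c W ∈ᵥ val F W) →
      (∀ W W' N : V, W ∈ᵥ S → W' ∈ᵥ S → (∀ x : V, x ∈ᵥ N ↔ (x ∈ᵥ W ∧ x ∈ᵥ W')) →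
        restr res W N (val c W) = restr res W' N (val c W')) →
      ∃ s : V, s ∈ᵥ val F U ∧ ∀ W : V, W ∈ᵥ S → restr res U W s = val c W) :=
  ⟨fun h => ⟨h.1, h.2, h.3, h.4, h.5⟩, fun h => ⟨h.1, h.2.1, h.2.2.1, h.2.2.2.1, h.2.2.2.2⟩⟩

theorem isIdealSheafOn_iff {X : RingedSpace V} {U I : V} : IsIdealSheafOn X U I ↔
    IsFamily I (X.OpenIn U) ∧ (∀ W : V, X.OpenIn U W → IsIdeal (X.ring W) (val I W)) ∧
    IsSheaf (X.OpenIn U) I X.res :=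
  ⟨fun h => ⟨h.1, h.2, h.3⟩, fun h => ⟨h.1, h.2.1, h.2.2⟩⟩

set_option synthInstance.maxHeartbeats 400000 in
set_option synthInstance.maxSize 4000 in
instance DefPred.isIdealSheafOn (X : RingedSpace V) (U : V) [DefFun s] :
    DefPred fun v => IsIdealSheafOn X U (s v) :=
  have : DefPred₁ fun I => IsIdealSheafOn X U I := by
    simp only [DefPred₁, isIdealSheafOn_iff, isSheaf_iff, IsCover]; infer_instance
  DefPred.comp₁ (fun I => IsIdealSheafOn X U I) s

instance DefPred.isIdealSheaf (X : RingedSpace V) [DefFun s] :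
    DefPred fun v => IsIdealSheaf X (s v) :=
  inferInstanceAs (DefPred fun v => IsIdealSheafOn X X.pts (s v))

theorem isModuleMap_iff {X : RingedSpace V} {I : V} {M : ModuleSheaf V} {φ : V} :
    IsModuleMap X I M φ ↔ IsFamily φ (fun U => U ∈ᵥ X.opens) ∧
    (∀ U : V, U ∈ᵥ X.opens → IsFun (val φ U) (val I U) (val M.car U)) ∧
    (∀ U s t : V, U ∈ᵥ X.opens → s ∈ᵥ val I U → t ∈ᵥ val I U →
      val (val φ U) ((X.ring U).plus s t) = M.plus U (val (val φ U) s) (val (val φ U) t)) ∧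
    (∀ U a s : V, U ∈ᵥ X.opens → a ∈ᵥ val X.car U → s ∈ᵥ val I U →
      val (val φ U) ((X.ring U).times a s) = M.act U a (val (val φ U) s)) ∧
    (∀ U W s : V, U ∈ᵥ X.opens → W ∈ᵥ X.opens → W ⊆ᵥ U → s ∈ᵥ val I U →
      val (val φ W) (restr X.res U W s) = restr M.res U W (val (val φ U) s)) :=
  ⟨fun h => ⟨h.1, h.2, h.3, h.4, h.5⟩, fun h => ⟨h.1, h.2.1, h.2.2.1, h.2.2.2.1, h.2.2.2.2⟩⟩

set_option synthInstance.maxHeartbeats 400000 in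
set_option synthInstance.maxSize 4000 in
instance DefPred.isModuleMap (X : RingedSpace V) (M : ModuleSheaf V) [DefFun s] [DefFun t] :
    DefPred fun v => IsModuleMap X (s v) M (t v) :=
  have : DefPred₂ fun I φ => IsModuleMap X I M φ := by
    simp only [DefPred₂, isModuleMap_iff]; infer_instance
  DefPred.comp₂ (fun I φ => IsModuleMap X I M φ) s t

instance DefPred.isHomSet (X : RingedSpace V) (M : ModuleSheaf V) [DefFun s] [DefFun t] :
    DefPred fun v => IsHomSet X (s v) M (t v) :=
  have : DefPred₂ fun I h => IsHomSet X I M h := by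
    simp only [DefPred₂, IsHomSet]; infer_instance
  DefPred.comp₂ (fun I h => IsHomSet X I M h) s t

instance DefPred.inGenerated (X : RingedSpace V) (U ρ : V) [DefFun r] [DefFun s] [DefFun t] :
    DefPred fun v => InGenerated X U ρ (r v) (s v) (t v) :=
  have : DefPred₃ fun W G s => InGenerated X U ρ W G s := by
    simp only [DefPred₃, InGenerated]; infer_instance
  DefPred.comp₃ (fun W G s => InGenerated X U ρ W G s) r s t

end Definability

variable [hV : Fact (IsModelZFG0 V)]

/-! ### Rings and ideals -/

section Rings

variable {R S : RingData V}

theorem IsCommRing.plus_mem (h : IsCommRing R) {x y : V} (hx : x ∈ᵥ R.car) (hy : y ∈ᵥ R.car) :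
    R.plus x y ∈ᵥ R.car :=
  h.add_fun.val_mem hx hy

theorem IsCommRing.times_mem (h : IsCommRing R) {x y : V} (hx : x ∈ᵥ R.car) (hy : y ∈ᵥ R.car) :
    R.times x y ∈ᵥ R.car :=
  h.mul_fun.val_mem hx hy

theorem IsCommRing.eq_zero_of_plus_self (h : IsCommRing R) {x : V} (hx : x ∈ᵥ R.car)
    (hxx : R.plus x x = x) : x = R.zero := by
  obtain ⟨y, hy, e⟩ := h.exists_neg x hx
  rw [← e]
  nth_rw 2 [← hxx]
  rw [← h.add_assoc y x x hy hx hx, e, h.zero_add x hx]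

theorem IsRingHom.map_zero {j : V → V} (h : IsRingHom R S j) (hR : IsCommRing R)
    (hS : IsCommRing S) : j R.zero = S.zero :=
  hS.eq_zero_of_plus_self (h.map_mem _ hR.zero_mem) (by
    rw [← h.map_add _ _ hR.zero_mem hR.zero_mem, hR.zero_add _ hR.zero_mem])

theorem IsIdeal.mem_of_times_unit_mem {J s u t : V} (hJ : IsIdeal R J) (hR : IsCommRing R)
    (hs : s ∈ᵥ R.car) (hu : u ∈ᵥ R.car) (ht : t ∈ᵥ R.car) (h : R.times u t = R.one)
    (hsu : R.times s u ∈ᵥ J) : s ∈ᵥ J := by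
  have := hJ.mul_mem t _ ht hsu
  rwa [hR.mul_comm _ _ ht (hR.times_mem hs hu), hR.mul_assoc _ _ _ hs hu ht, h,
    hR.mul_comm _ _ hs hR.one_mem, hR.one_mul _ hs] at this

/-- The preimage of an ideal under a ring homomorphism. -/
theorem IsRingHom.isIdeal_comap {j : V → V} [DefFun₁ j] (h : IsRingHom R S j) (hR : IsCommRing R)
    (hS : IsCommRing S) {J : V} (hJ : IsIdeal S J) : IsIdeal R (sep (fun x => j x ∈ᵥ J) R.car) := by
  simp only [isIdeal_iff, mem_sep]
  refine ⟨fun x hx => (mem_sep.1 hx).1, ⟨hR.zero_mem, ?_⟩, fun x y hx hy => ⟨hR.plus_mem hx.1 hy.1, ?_⟩,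
    fun a x ha hx => ⟨hR.times_mem ha hx.1, ?_⟩⟩
  · rw [h.map_zero hR hS]
    exact hJ.zero_mem
  · rw [h.map_add _ _ hx.1 hy.1]
    exact hJ.add_mem _ _ hx.2 hy.2
  · rw [h.map_mul _ _ ha hx.1]
    exact hJ.mul_mem _ _ (h.map_mem _ ha) hx.2

/-- The ideal of `R` generated by the set `A`. -/
noncomputable def gen (R : RingData V) (A : V) : V :=
  sep (fun r => ∀ J, IsIdeal R J → A ⊆ᵥ J → r ∈ᵥ J) R.car

instance DefFun.gen {k : ℕ} {s : (Fin k → V) → V} [DefFun s] : DefFun fun v => gen R (s v) :=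
  have : DefFun₁ (ZFG.gen R) := by simp only [DefFun₁, ZFG.gen]; infer_instance
  DefFun.comp₁ (ZFG.gen R) s

theorem isIdeal_gen (hR : IsCommRing R) (A : V) : IsIdeal R (gen R A) := by
  rw [isIdeal_iff]
  simp only [gen, mem_sep]
  exact ⟨fun x hx => (mem_sep.1 hx).1, ⟨hR.zero_mem, fun J hJ _ => hJ.zero_mem⟩,
    fun x y hx hy => ⟨hR.plus_mem hx.1 hy.1, fun J hJ hA =>
      hJ.add_mem _ _ (hx.2 J hJ hA) (hy.2 J hJ hA)⟩,
    fun a x ha hx => ⟨hR.times_mem ha hx.1, fun J hJ hA => hJ.mul_mem _ _ ha (hx.2 J hJ hA)⟩⟩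

theorem subset_gen {A : V} (hA : A ⊆ᵥ R.car) : A ⊆ᵥ gen R A :=
  fun x hx => mem_sep.2 ⟨hA x hx, fun _ _ h => h x hx⟩

theorem gen_subset {A J : V} (hJ : IsIdeal R J) (hA : A ⊆ᵥ J) : gen R A ⊆ᵥ J :=
  fun _ hx => (mem_sep.1 hx).2 J hJ hA

theorem IsNoetherianRing.exists_gen_eq (hR : IsNoetherianRing R) {J : V} (hJ : IsIdeal R J) :
    ∃ G, IsFinite G ∧ G ⊆ᵥ R.car ∧ gen R G = J := by
  obtain ⟨G, hG, hGJ, h⟩ := hR.2 J hJ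
  have hGR := hGJ.trans hJ.sub
  exact ⟨G, hG, hGR, (gen_subset hJ hGJ).antisymm (h _ (isIdeal_gen hR.1 G) (subset_gen hGR))⟩

/-- Finite subsets form a set and `gen` maps them onto the ideals. This bounds the classes of ideals
in which chains are built. -/
theorem IsNoetherianRing.exists_ideals (hR : IsNoetherianRing R) :
    ∃ S : V, ∀ J, IsIdeal R J → J ∈ᵥ S := by
  refine ⟨img (gen R) (finSub R.car), fun J hJ => ?_⟩
  obtain ⟨G, hG, hGR, rfl⟩ := hR.exists_gen_eq hJ
  exact mem_img.2 ⟨G, mem_finSub.2 ⟨hG, hGR⟩, rfl⟩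

/-- A finite subset of the union of a non-empty chain is contained in a member of the chain. -/
theorem IsFinite.exists_subset_of_chain {T G : V} (hne : ∃ x, x ∈ᵥ T)
    (hT : ∀ x y, x ∈ᵥ T → y ∈ᵥ T → x ⊆ᵥ y ∨ y ⊆ᵥ x) (hG : IsFinite G) (h : G ⊆ᵥ ZFG.sUnion T) :
    ∃ x, x ∈ᵥ T ∧ G ⊆ᵥ x := by
  refine IsFinite.induction (Q := fun G => G ⊆ᵥ ZFG.sUnion T → ∃ x, x ∈ᵥ T ∧ G ⊆ᵥ x)
    (fun _ => ?_) (fun A a _ ih h => ?_) hG h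
  · obtain ⟨x, hx⟩ := hne
    exact ⟨x, hx, fun y hy => (notMem_emp hy).elim⟩
  · obtain ⟨x, hx, hAx⟩ := ih fun z hz => h z (mem_ins.2 (Or.inl hz))
    obtain ⟨y, hy, hay⟩ := mem_sUnion.1 (h a (mem_ins.2 (Or.inr rfl)))
    rcases hT x y hx hy with hxy | hyx
    · refine ⟨y, hy, fun z hz => ?_⟩
      rcases mem_ins.1 hz with hz | rfl
      · exact hxy z (hAx z hz)
      · exact hay
    · refine ⟨x, hx, fun z hz => ?_⟩
      rcases mem_ins.1 hz with hz | rfl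
      · exact hAx z hz
      · exact hyx z hay

/-- For a definable operation `nxt` with `x ⊆ nxt x` on the set `B`, there is a subset of `B` that
contains `a`, is closed under `nxt`, and is linearly ordered by inclusion. -/
theorem exists_chain {nxt : V → V} [hn : DefFun₁ nxt] {B a : V} (ha : a ∈ᵥ B)
    (hB : ∀ x, x ∈ᵥ B → nxt x ∈ᵥ B) (hle : ∀ x, x ∈ᵥ B → x ⊆ᵥ nxt x) :
    ∃ T, T ⊆ᵥ B ∧ a ∈ᵥ T ∧ (∀ x, x ∈ᵥ T → nxt x ∈ᵥ T) ∧
      ∀ x y, x ∈ᵥ T → y ∈ᵥ T → x ⊆ᵥ y ∨ y ⊆ᵥ x := by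
  have hn' : ∀ {k : ℕ} (s : (Fin k → V) → V) [DefFun s], DefFun fun v => nxt (s v) :=
    fun s => DefFun.comp₁ nxt s
  have : DefPred₁ fun x => ∀ C, a ∈ᵥ C → (∀ y, y ∈ᵥ C → nxt y ∈ᵥ C) → x ∈ᵥ C := by
    have := hn' fun v : Fin 3 → V => v 0
    infer_instance
  -- `T` is the part of `B` common to all sets that contain `a` and are closed under `nxt`. Its
  -- minimality gives the induction principle `ind` for definable predicates.
  obtain ⟨T, hT⟩ : ∃ T, ∀ x, x ∈ᵥ T ↔
      x ∈ᵥ B ∧ ∀ C, a ∈ᵥ C → (∀ y, y ∈ᵥ C → nxt y ∈ᵥ C) → x ∈ᵥ C := ⟨_, fun x => mem_sep⟩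
  have haT : a ∈ᵥ T := (hT a).2 ⟨ha, fun C h _ => h⟩
  have hnT : ∀ x, x ∈ᵥ T → nxt x ∈ᵥ T := fun x hx =>
    (hT _).2 ⟨hB x ((hT x).1 hx).1, fun C h h' => h' x (((hT x).1 hx).2 C h h')⟩
  have hTB : T ⊆ᵥ B := fun x hx => ((hT x).1 hx).1
  have ind : ∀ (P : V → Prop) [DefPred₁ P], P a → (∀ x, x ∈ᵥ T → P x → P (nxt x)) →
      ∀ x, x ∈ᵥ T → P x := fun P _ h₀ h₁ x hx =>
    (mem_sep.1 (((hT x).1 hx).2 (sep P T) (mem_sep.2 ⟨haT, h₀⟩) fun y hy =>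
      mem_sep.2 ⟨hnT y (mem_sep.1 hy).1, h₁ y (mem_sep.1 hy).1 (mem_sep.1 hy).2⟩)).2
  have hmin : ∀ x, x ∈ᵥ T → a ⊆ᵥ x :=
    ind (fun x => a ⊆ᵥ x) (Sub.refl a) fun x hx h => h.trans (hle x (hTB x hx))
  -- As in the Bourbaki–Witt argument, without limit stages: call x good if nxt y ⊆ x for every y in
  -- `T` properly below x. Nothing in `T` falls between a good x and nxt x, and from this every x is
  -- good.
  have key : ∀ x, x ∈ᵥ T → (∀ y, y ∈ᵥ T → y ⊆ᵥ x → y ≠ x → nxt y ⊆ᵥ x) →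
      ∀ y, y ∈ᵥ T → y ⊆ᵥ x ∨ nxt x ⊆ᵥ y := fun x hx hgood => by
    refine ind (fun y => y ⊆ᵥ x ∨ nxt x ⊆ᵥ y) (Or.inl (hmin x hx)) fun y hy h => ?_
    rcases h with h | h
    · by_cases e : y = x
      · exact Or.inr (e ▸ Sub.refl _)
      · exact Or.inl (hgood y hy h e)
    · exact Or.inr (h.trans (hle y (hTB y hy)))
  have good : ∀ x, x ∈ᵥ T → ∀ y, y ∈ᵥ T → y ⊆ᵥ x → y ≠ x → nxt y ⊆ᵥ x := by
    have : DefPred₁ fun x => ∀ y, y ∈ᵥ T → y ⊆ᵥ x → y ≠ x → nxt y ⊆ᵥ x := by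
      have := hn' fun v : Fin 2 → V => v 0
      infer_instance
    refine ind _ (fun y hy h h' => (h' (h.antisymm (hmin y hy))).elim) fun x hx hgood y hy h h' => ?_
    rcases key x hx hgood y hy with hyx | hxy
    · by_cases e : y = x
      · exact e ▸ Sub.refl _
      · exact (hgood y hy hyx e).trans (hle x (hTB x hx))
    · exact (h' (h.antisymm hxy)).elim
  refine ⟨T, hTB, haT, hnT, fun x y hx hy => ?_⟩
  rcases key y hy (good y hy) x hx with h | h
  · exact Or.inl h
  · exact Or.inr ((hle y (hTB y hy)).trans h)

/-- A non-empty definable class of ideals of a Noetherian ring has a maximal element. -/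
theorem IsNoetherianRing.exists_maximal (hR : IsNoetherianRing R) (P : V → Prop) [hP : DefPred₁ P]
    (hideal : ∀ J, P J → IsIdeal R J) (hne : ∃ J, P J) :
    ∃ J, P J ∧ ∀ J', P J' → J ⊆ᵥ J' → J' = J := by
  by_contra! hmax
  obtain ⟨S, hS⟩ := hR.exists_ideals
  have hP' : DefPred fun v : Fin 2 → V => P (v 0) := DefPred.comp₁ P _
  let nxt : V → V := fun J => least (fun J' => P J' ∧ J ⊆ᵥ J' ∧ J' ≠ J) J
  have hn : DefFun₁ nxt := inferInstance
  have hnxt : ∀ J, P J → P (nxt J) ∧ J ⊆ᵥ nxt J ∧ nxt J ≠ J := fun J hJ =>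
    least_spec (P := fun J' => P J' ∧ J ⊆ᵥ J' ∧ J' ≠ J) (hmax J hJ)
  have hB : ∀ J, J ∈ᵥ sep P S ↔ P J := fun J => by
    rw [mem_sep, and_iff_right_iff_imp]
    exact fun h => hS J (hideal J h)
  obtain ⟨J₀, h₀⟩ := hne
  obtain ⟨T, hTB, h₀T, hnT, hchain⟩ := exists_chain (nxt := nxt) ((hB J₀).2 h₀)
    (fun J hJ => (hB _).2 (hnxt J ((hB J).1 hJ)).1) (fun J hJ => (hnxt J ((hB J).1 hJ)).2.1)
  have hTP : ∀ J, J ∈ᵥ T → P J := fun J hJ => (hB J).1 (hTB J hJ)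
  have hU : IsIdeal R (sUnion T) := by
    simp only [isIdeal_iff, mem_sUnion]
    refine ⟨fun x hx => ?_, ⟨J₀, h₀T, (hideal _ h₀).zero_mem⟩, ?_, ?_⟩
    · obtain ⟨J, hJ, hx⟩ := mem_sUnion.1 hx
      exact (hideal J (hTP J hJ)).sub x hx
    · rintro x y ⟨J, hJ, hx⟩ ⟨J', hJ', hy⟩
      rcases hchain J J' hJ hJ' with h | h
      · exact ⟨J', hJ', (hideal J' (hTP J' hJ')).add_mem x y (h x hx) hy⟩
      · exact ⟨J, hJ, (hideal J (hTP J hJ)).add_mem x y hx (h y hy)⟩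
    · rintro a x ha ⟨J, hJ, hx⟩
      exact ⟨J, hJ, (hideal J (hTP J hJ)).mul_mem a x ha hx⟩
  obtain ⟨G, hG, hGU, hgen⟩ := hR.2 _ hU
  obtain ⟨J, hJ, hGJ⟩ := hG.exists_subset_of_chain ⟨J₀, h₀T⟩ hchain hGU
  -- `J` contains generators of the whole union, hence contains `nxt J`, which was chosen strictly
  -- larger.
  obtain ⟨-, hle, hneq⟩ := hnxt J (hTP J hJ)
  refine hneq (Sub.antisymm (fun x hx => ?_) hle)
  exact hgen J (hideal J (hTP J hJ)) hGJ x (mem_sUnion.2 ⟨_, hnT J hJ, hx⟩)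

end Rings

end ZFG

namespace ZFG

variable {V : Type u} [SetUniverse V] [hV : Fact (IsModelZFG0 V)]
variable {X : RingedSpace V} {U W I J : V}

/-! ### Sheaves of ideals -/

theorem IsRingedSpace.openIn_pts (hX : IsRingedSpace X) (hU : U ∈ᵥ X.opens) : X.OpenIn X.pts U :=
  ⟨hU, hX.top.sub U hU⟩

theorem IsRingedSpace.inter_mem (hX : IsRingedSpace X) (hU : U ∈ᵥ X.opens) (hW : W ∈ᵥ X.opens) :
    inter U W ∈ᵥ X.opens := by
  obtain ⟨N, hN, h⟩ := hX.top.inter U W hU hW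
  rwa [show inter U W = N from set_ext fun x => by rw [mem_inter, h]]

theorem IsCover.sub {Op : V → Prop} {S : V} (h : IsCover Op U S) (hW : W ∈ᵥ S) : W ⊆ᵥ U :=
  fun x hx => (h.2 x).2 ⟨W, hW, hx⟩

theorem IsRingedSpace.cover_pts (hX : IsRingedSpace X) {N S : V}
    (hS : IsCover (X.OpenIn N) W S) : IsCover (X.OpenIn X.pts) W S :=
  ⟨fun W' hW' => hX.openIn_pts (hS.1 W' hW').1, hS.2⟩

theorem IsCover.inter (hX : IsRingedSpace X) {C : V} (hC : IsCover (X.OpenIn X.pts) X.pts C)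
    (hW : W ∈ᵥ X.opens) : IsCover (X.OpenIn X.pts) W (img (fun U => ZFG.inter W U) C) := by
  refine ⟨fun N hN => ?_, fun x => ?_⟩
  · obtain ⟨U, hU, rfl⟩ := mem_img.1 hN
    exact hX.openIn_pts (hX.inter_mem hW (hC.1 U hU).1)
  · simp only [mem_img]
    constructor
    · intro hx
      obtain ⟨U, hU, hxU⟩ := (hC.2 x).1 (hX.top.sub W hW x hx)
      exact ⟨_, ⟨U, hU, rfl⟩, by simp [hx, hxU]⟩
    · rintro ⟨_, ⟨U, hU, rfl⟩, hx⟩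
      exact (mem_inter.1 hx).1

/-- A section that lies locally in a sheaf of ideals lies in it. -/
theorem IsIdealSheafOn.mem_of_locally_mem (hX : IsRingedSpace X) (hJ : IsIdealSheafOn X U J)
    {S s : V} (hW : X.OpenIn U W) (hs : s ∈ᵥ val X.car W) (hS : IsCover (X.OpenIn U) W S)
    (h : ∀ W', W' ∈ᵥ S → restr X.res W W' s ∈ᵥ val J W') : s ∈ᵥ val J W := by
  have hval : ∀ W', W' ∈ᵥ S → val (fam (fun W' => restr X.res W W' s) S) W' = restr X.res W W' s :=
    fun W' hW' => val_fam hW'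
  obtain ⟨t, ht, hts⟩ := hJ.sheaf.glue W S (fam (fun W' => restr X.res W W' s) S) hW hS
    (isFamily_fam _ _) (fun W' hW' => by rw [hval W' hW']; exact h W' hW')
    (fun W₁ W₂ N h₁ h₂ hN => by
      have e : N = inter W₁ W₂ := set_ext fun x => by rw [hN, mem_inter]
      have hNo : N ∈ᵥ X.opens := e ▸ hX.inter_mem (hS.1 _ h₁).1 (hS.1 _ h₂).1
      rw [hval _ h₁, hval _ h₂,
        hX.sheaf.restr_restr W W₁ N s (hX.openIn_pts hW.1) (hX.openIn_pts (hS.1 _ h₁).1)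
          (hX.openIn_pts hNo) (hS.sub h₁) (fun x hx => ((hN x).1 hx).1) hs,
        hX.sheaf.restr_restr W W₂ N s (hX.openIn_pts hW.1) (hX.openIn_pts (hS.1 _ h₂).1)
          (hX.openIn_pts hNo) (hS.sub h₂) (fun x hx => ((hN x).1 hx).2) hs])
  -- The section `t` glued inside `J` has the same restrictions as `s`, so the structure sheaf
  -- identifies the two.
  rwa [hX.sheaf.eq_of_locally_eq W S s t (hX.openIn_pts hW.1) (hX.cover_pts hS) hs
    ((hJ.ideal W hW).sub t ht) fun W' hW' => by rw [hts W' hW', hval W' hW']]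

/-- A family of ideals that is stable under restriction and locally determined is a sheaf. -/
theorem isIdealSheafOn_of_local (hX : IsRingedSpace X) (hfam : IsFamily J (X.OpenIn U))
    (hideal : ∀ W, X.OpenIn U W → IsIdeal (X.ring W) (val J W))
    (hres : ∀ W N s, X.OpenIn U W → X.OpenIn U N → N ⊆ᵥ W → s ∈ᵥ val J W →
      restr X.res W N s ∈ᵥ val J N)
    (hloc : ∀ W S s, X.OpenIn U W → IsCover (X.OpenIn U) W S → s ∈ᵥ val X.car W →
      (∀ N, N ∈ᵥ S → restr X.res W N s ∈ᵥ val J N) → s ∈ᵥ val J W) : IsIdealSheafOn X U J where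
  family := hfam
  ideal := hideal
  sheaf :=
    { restr_mem := hres
      restr_self := fun W s hW hs =>
        hX.sheaf.restr_self W s (hX.openIn_pts hW.1) ((hideal W hW).sub s hs)
      restr_restr := fun W N N' s hW hN hN' h h' hs =>
        hX.sheaf.restr_restr W N N' s (hX.openIn_pts hW.1) (hX.openIn_pts hN.1)
          (hX.openIn_pts hN'.1) h h' ((hideal W hW).sub s hs)
      eq_of_locally_eq := fun W S s t hW hS hs ht h =>
        hX.sheaf.eq_of_locally_eq W S s t (hX.openIn_pts hW.1) (hX.cover_pts hS)
          ((hideal W hW).sub s hs) ((hideal W hW).sub t ht) h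
      glue := fun W S c hW hS hc hmem h => by
        obtain ⟨s, hs, hsc⟩ := hX.sheaf.glue W S c (hX.openIn_pts hW.1) (hX.cover_pts hS) hc
          (fun N hN => (hideal N (hS.1 N hN)).sub _ (hmem N hN)) h
        exact ⟨s, hloc W S s hW hS hs fun N hN => by rw [hsc N hN]; exact hmem N hN, hsc⟩ }

theorem IsFamily.of_iff {f : V} {D D' : V → Prop} (h : IsFamily f D) (h' : ∀ x, D x ↔ D' x) :
    IsFamily f D' := by
  rwa [← funext fun x => propext (h' x)]

/-- A definable family of subsets of the rings of sections. -/
theorem exists_family (X : RingedSpace V) (U : V) (t : V → V) [DefFun₁ t] :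
    ∃ J, IsFamily J (X.OpenIn U) ∧ ∀ W, X.OpenIn U W → val J W = t W := by
  have h : ∀ W, W ∈ᵥ sep (fun W => W ⊆ᵥ U) X.opens ↔ X.OpenIn U W := fun W => mem_sep
  exact ⟨fam t (sep (fun W => W ⊆ᵥ U) X.opens), (isFamily_fam _ _).of_iff h,
    fun W hW => val_fam ((h W).2 hW)⟩

/-! ### Module maps and the sheaf on which two of them agree -/

section Maps

variable {M : ModuleSheaf V} {φ ψ : V}

theorem IsModuleSheaf.eq_zero_of_plus_self (hM : IsModuleSheaf X M) {m : V} (hU : U ∈ᵥ X.opens)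
    (hm : m ∈ᵥ val M.car U) (h : M.plus U m m = m) : m = val M.zero U := by
  obtain ⟨n, hn, e⟩ := hM.exists_neg U m hU hm
  rw [← e]
  nth_rw 2 [← h]
  rw [← hM.add_assoc U n m m hU hn hm hm, e, hM.zero_add U m hU hm]

theorem IsModuleMap.map_zero (hX : IsRingedSpace X) (hM : IsModuleSheaf X M)
    (hI : IsIdealSheaf X I) (hφ : IsModuleMap X I M φ) (hU : U ∈ᵥ X.opens) :
    val (val φ U) (X.ring U).zero = val M.zero U := by
  have hz := (hI.ideal U (hX.openIn_pts hU)).zero_mem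
  refine hM.eq_zero_of_plus_self hU ((hφ.isFun U hU).val_mem hz) ?_
  rw [← hφ.map_add U _ _ hU hz hz, (hX.isCommRing U hU).zero_add _ (hX.isCommRing U hU).zero_mem]

/-- Two sections of a sheaf of modules that agree locally are equal, in terms of module maps. -/
theorem IsModuleMap.eq_of_locally_eq (hX : IsRingedSpace X) (hM : IsModuleSheaf X M)
    (hφ : IsModuleMap X I M φ) (hψ : IsModuleMap X I M ψ) {S s : V} (hW : W ∈ᵥ X.opens)
    (hS : IsCover (X.OpenIn X.pts) W S) (hs : s ∈ᵥ val I W)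
    (h : ∀ N, N ∈ᵥ S → val (val φ N) (restr X.res W N s) = val (val ψ N) (restr X.res W N s)) :
    val (val φ W) s = val (val ψ W) s :=
  hM.sheaf.eq_of_locally_eq W S _ _ (hX.openIn_pts hW) hS ((hφ.isFun W hW).val_mem hs)
    ((hψ.isFun W hW).val_mem hs) fun N hN => by
      rw [← hφ.map_restr W N s hW (hS.1 N hN).1 (hS.sub hN) hs,
        ← hψ.map_restr W N s hW (hS.1 N hN).1 (hS.sub hN) hs, h N hN]

/-- The sections on which two module maps agree form a sheaf of ideals. -/
theorem exists_equalizer (hX : IsRingedSpace X) (hM : IsModuleSheaf X M)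
    (hI : IsIdealSheaf X I) (hφ : IsModuleMap X I M φ) (hψ : IsModuleMap X I M ψ) (U : V) :
    ∃ J, IsIdealSheafOn X U J ∧ ∀ W, X.OpenIn U W → ∀ s, s ∈ᵥ val J W ↔
      s ∈ᵥ val I W ∧ val (val φ W) s = val (val ψ W) s := by
  obtain ⟨J, hJ, h⟩ := exists_family X U
    (fun W => sep (fun s => val (val φ W) s = val (val ψ W) s) (val I W))
  have hmem : ∀ W, X.OpenIn U W → ∀ s, s ∈ᵥ val J W ↔
      s ∈ᵥ val I W ∧ val (val φ W) s = val (val ψ W) s := fun W hW s => by rw [h W hW, mem_sep]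
  have hideal : ∀ W, X.OpenIn U W → IsIdeal (X.ring W) (val I W) :=
    fun W hW => hI.ideal W (hX.openIn_pts hW.1)
  refine ⟨J, isIdealSheafOn_of_local hX hJ (fun W hW => ?_) (fun W N s hW hN hNW hs => ?_)
    (fun W S s hW hS hs hloc => ?_), hmem⟩
  · have hI' := hideal W hW
    rw [isIdeal_iff]
    simp only [hmem W hW]
    refine ⟨fun s hs => hI'.sub s ((hmem W hW s).1 hs).1, ⟨hI'.zero_mem, ?_⟩,
      fun s t hs ht => ⟨hI'.add_mem s t hs.1 ht.1, ?_⟩,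
      fun a s ha hs => ⟨hI'.mul_mem a s ha hs.1, ?_⟩⟩
    · rw [hφ.map_zero hX hM hI hW.1, hψ.map_zero hX hM hI hW.1]
    · rw [hφ.map_add W s t hW.1 hs.1 ht.1, hψ.map_add W s t hW.1 hs.1 ht.1, hs.2, ht.2]
    · rw [hφ.map_mul W a s hW.1 ha hs.1, hψ.map_mul W a s hW.1 ha hs.1, hs.2]
  · rw [hmem W hW] at hs
    rw [hmem N hN, hφ.map_restr W N s hW.1 hN.1 hNW hs.1, hψ.map_restr W N s hW.1 hN.1 hNW hs.1,
      hs.2]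
    exact ⟨hI.sheaf.restr_mem W N s (hX.openIn_pts hW.1) (hX.openIn_pts hN.1) hNW hs.1, rfl⟩
  -- Membership in `I` comes from gluing in `I`, and equality of the two values from uniqueness in
  -- `M`.
  · have hsI : s ∈ᵥ val I W := hI.mem_of_locally_mem hX (hX.openIn_pts hW.1) hs (hX.cover_pts hS)
      fun N hN => ((hmem N (hS.1 N hN) _).1 (hloc N hN)).1
    exact (hmem W hW s).2 ⟨hsI, hφ.eq_of_locally_eq hX hM hψ hW.1 (hX.cover_pts hS) hsI
      fun N hN => ((hmem N (hS.1 N hN) _).1 (hloc N hN)).2⟩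

theorem IsModuleMap.val_eq_val (hφ : IsModuleMap X I M φ) (hψ : IsModuleMap X I M ψ)
    (hW : W ∈ᵥ X.opens) (h : ∀ s, s ∈ᵥ val I W → val (val φ W) s = val (val ψ W) s) :
    val φ W = val ψ W :=
  (hφ.isFun W hW).ext (hψ.isFun W hW) h

/-- Module maps that agree on the open sets in the members of a covering are equal. -/
theorem IsModuleMap.eq_of_cover (hX : IsRingedSpace X) (hM : IsModuleSheaf X M)
    (hφ : IsModuleMap X I M φ) (hψ : IsModuleMap X I M ψ) {C : V} (hC : IsCover (X.OpenIn X.pts) X.pts C)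
    (h : ∀ U, U ∈ᵥ C → ∀ W, X.OpenIn U W → val φ W = val ψ W) : φ = ψ := by
  refine hφ.family.ext hψ.family fun W hW => hφ.val_eq_val hψ hW fun s hs => ?_
  refine hφ.eq_of_locally_eq hX hM hψ hW (hC.inter hX hW) hs fun N hN => ?_
  obtain ⟨U, hU, rfl⟩ := mem_img.1 hN
  rw [h U hU _ ⟨hX.inter_mem hW (hC.1 U hU).1, fun x hx => (mem_inter.1 hx).2⟩]

end Maps

end ZFG

namespace ZFG

variable {V : Type u} [SetUniverse V]

/-! ### Affine open sets -/

/-- The preimage of `D(f)` in `U`. -/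
noncomputable def dist (U θ f : V) : V := sep (fun x => ¬ f ∈ᵥ val θ x) U

/-- The ideal of the elements of `R` whose restriction to `W` is a section of `I`. -/
noncomputable def contraction (X : RingedSpace V) (U : V) (R : RingData V) (ρ I W : V) : V :=
  sep (fun a => restr X.res U W (val ρ a) ∈ᵥ val I W) R.car

section Definability

variable {k : ℕ} {s : (Fin k → V) → V}

instance DefFun.dist (U θ : V) [DefFun s] : DefFun fun v => dist U θ (s v) :=
  have : DefFun₁ (ZFG.dist U θ) := by simp only [DefFun₁, ZFG.dist]; infer_instance
  DefFun.comp₁ (ZFG.dist U θ) s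

instance DefFun.contraction (X : RingedSpace V) (U : V) (R : RingData V) (ρ I : V) [DefFun s] :
    DefFun fun v => contraction X U R ρ I (s v) :=
  have : DefFun₁ (ZFG.contraction X U R ρ I) := by
    simp only [DefFun₁, ZFG.contraction]; infer_instance
  DefFun.comp₁ (ZFG.contraction X U R ρ I) s

end Definability

variable [hV : Fact (IsModelZFG0 V)]
variable {X : RingedSpace V} {U W I J : V} {R : RingData V} {θ ρ : V}

@[simp] theorem mem_dist {f x : V} : x ∈ᵥ dist U θ f ↔ x ∈ᵥ U ∧ ¬ f ∈ᵥ val θ x := mem_sep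

theorem isDistinguished_dist (U θ f : V) : IsDistinguished U θ f (dist U θ f) :=
  fun _ => mem_dist

theorem IsDistinguished.eq_dist {f : V} (h : IsDistinguished U θ f W) : W = dist U θ f :=
  set_ext fun x => by rw [h x, mem_dist]

theorem dist_subset (U θ f : V) : dist U θ f ⊆ᵥ U := fun _ hx => (mem_dist.1 hx).1

/-- D(f) is the complement of the closed set of the principal ideal, generated by the singleton
`upair f f`. -/
theorem IsAffineChart.openIn_dist (hc : IsAffineChart X U R θ ρ) (hR : IsCommRing R) {f : V}
    (hf : f ∈ᵥ R.car) : X.OpenIn U (dist U θ f) := by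
  have hs : upair f f ⊆ᵥ R.car := fun x hx => by
    rcases mem_upair.1 hx with rfl | rfl <;> exact hf
  refine ⟨(hc.open_iff _ (dist_subset U θ f)).2 ⟨gen R (upair f f), isIdeal_gen hR _,
    fun x hx => ?_⟩, dist_subset U θ f⟩
  rw [mem_dist, and_iff_right hx, not_iff_not]
  refine ⟨fun h => gen_subset (hc.θ_prime x hx).ideal fun y hy => ?_,
    fun h => h f (subset_gen hs f (by simp))⟩
  rcases mem_upair.1 hy with rfl | rfl <;> exact h

theorem IsAffineChart.openIn_of_isDistinguished (hc : IsAffineChart X U R θ ρ)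
    (hR : IsCommRing R) {f : V} (hf : f ∈ᵥ R.car) (h : IsDistinguished U θ f W) :
    X.OpenIn U W :=
  h.eq_dist ▸ hc.openIn_dist hR hf

theorem IsAffineChart.dist_one (hc : IsAffineChart X U R θ ρ) : dist U θ R.one = U :=
  set_ext fun x => by
    rw [mem_dist, and_iff_left_iff_imp]
    exact fun hx => (hc.θ_prime x hx).one_notMem

/-- The distinguished open sets are a basis of the topology. -/
theorem IsAffineChart.exists_dist_subset (hc : IsAffineChart X U R θ ρ) (hW : X.OpenIn U W)
    {x : V} (hx : x ∈ᵥ W) : ∃ f, f ∈ᵥ R.car ∧ x ∈ᵥ dist U θ f ∧ dist U θ f ⊆ᵥ W := by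
  obtain ⟨J, hJ, h⟩ := (hc.open_iff W hW.2).1 hW.1
  have hx' := (h x (hW.2 x hx)).1 hx
  simp only [Sub, not_forall] at hx'
  obtain ⟨f, hf, hfx⟩ := hx'
  refine ⟨f, hJ.sub f hf, mem_dist.2 ⟨hW.2 x hx, hfx⟩, fun y hy => ?_⟩
  obtain ⟨hy, hfy⟩ := mem_dist.1 hy
  exact (h y hy).2 fun h' => hfy (h' f hf)

theorem IsGeneratorDigraph.openIn_of_node {N E r W G : V}
    (h : IsGeneratorDigraph X U R θ ρ N E r) (hR : IsNoetherianRing R)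
    (hc : IsAffineChart X U R θ ρ) (hn : pair W G ∈ᵥ N) : X.OpenIn U W := by
  obtain ⟨W', G', e, ⟨f, hf, hW'⟩, -⟩ := h.node _ hn
  obtain ⟨rfl, rfl⟩ := pair_inj.1 e
  exact hc.openIn_of_isDistinguished hR.1 hf hW'

/-- The values on the generators determine a module map on the opens in `U`. -/
theorem val_eq_val_of_agreeOnGenerators (hX : IsRingedSpace X) (hM : IsModuleSheaf X M)
    (hI : IsIdealSheaf X I) {R : RingData V} {θ ρ N E r : V}
    (hN : IsFiniteDigraphFor X I U R θ ρ N E r) (hφ : IsModuleMap X I M φ)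
    (hψ : IsModuleMap X I M ψ) (h : AgreeOnGenerators X U ρ N φ ψ) (hW : X.OpenIn U W) :
    val φ W = val ψ W := by
  -- The equalizer is a sheaf of ideals on `U` containing the generators, so by minimality it
  -- contains `I` over every open subset of `U`.
  obtain ⟨J, hJ, hmem⟩ := exists_equalizer hX hM hI hφ hψ U
  obtain ⟨hR, hchart, -, hdig, hgen⟩ := hN
  refine hφ.val_eq_val hψ hW.1 fun s hs => ((hmem W hW s).1 (hgen.2 J hJ ?_ W hW s hs)).2
  intro W' G g hn hg
  have hW' := hdig.openIn_of_node hR hchart hn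
  exact (hmem W' hW' _).2 ⟨hgen.1 W' G g hn hg, h W' G g hn hg⟩


theorem IsAffineChart.isRingHom_dist (hc : IsAffineChart X U R θ ρ) {f : V} (hf : f ∈ᵥ R.car) :
    IsRingHom R (X.ring (dist U θ f)) fun a => restr X.res U (dist U θ f) (val ρ a) :=
  (hc.localization f _ hf (isDistinguished_dist U θ f)).hom

/-- Powers of `f` become units in a localization at `f`. -/
theorem IsLocalizationAway.isUnit_of_isPower {S : RingData V} {f e : V} {j : V → V} [DefFun₁ j]
    (h : IsLocalizationAway R f S j) (hR : IsCommRing R) (hS : IsCommRing S) (hf : f ∈ᵥ R.car)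
    (he : IsPower R f e) : e ∈ᵥ R.car ∧ ∃ t, t ∈ᵥ S.car ∧ S.times (j e) t = S.one := by
  have hj : DefFun fun v : Fin 2 → V => j (v (Fin.succ 0)) := DefFun.comp₁ j _
  -- Powers are the elements of every set that contains 1 and is closed under multiplication by f;
  -- the set used here consists of the elements of `R` with invertible image.
  refine mem_sep.1 (he (sep (fun x => ∃ t, t ∈ᵥ S.car ∧ S.times (j x) t = S.one) R.car) ?_ ?_)
  · rw [mem_sep, h.hom.map_one]
    exact ⟨hR.one_mem, S.one, hS.one_mem, hS.one_mul _ hS.one_mem⟩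
  · intro x hx
    obtain ⟨hx, t, ht, hxt⟩ := mem_sep.1 hx
    obtain ⟨u, hu, hfu⟩ := h.isUnit
    have hjx := h.hom.map_mem x hx
    have hjf := h.hom.map_mem f hf
    refine mem_sep.2 ⟨hR.times_mem hf hx, S.times t u, hS.times_mem ht hu, ?_⟩
    rw [h.hom.map_mul f x hf hx, hS.mul_assoc _ _ _ hjf hjx (hS.times_mem ht hu),
      ← hS.mul_assoc _ _ _ hjx ht hu, hxt, hS.one_mul u hu, hfu]

/-- Up to a unit, a section over a distinguished open set comes from `R`. -/
theorem IsAffineChart.exists_mem_iff (hX : IsRingedSpace X) (hc : IsAffineChart X U R θ ρ)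
    (hR : IsCommRing R) {f s : V} (hf : f ∈ᵥ R.car) (hs : s ∈ᵥ val X.car (dist U θ f)) :
    ∃ a, a ∈ᵥ R.car ∧ ∀ J, IsIdeal (X.ring (dist U θ f)) J →
      (s ∈ᵥ J ↔ restr X.res U (dist U θ f) (val ρ a) ∈ᵥ J) := by
  have hS := hX.isCommRing _ (hc.openIn_dist hR hf).1
  have hloc := hc.localization f _ hf (isDistinguished_dist U θ f)
  -- The image of `a` is `s` times the image of the power `e`. The latter is a unit, so `s` and the
  -- image of `a` lie in the same ideals.
  obtain ⟨a, e, ha, he, hsa⟩ := hloc.surj s hs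
  obtain ⟨heR, t, ht, het⟩ := hloc.isUnit_of_isPower hR hS hf he
  have hje := hloc.hom.map_mem e heR
  refine ⟨a, ha, fun J hJ => ⟨fun h => ?_, fun h => ?_⟩⟩
  · have := hJ.mul_mem _ s hje h
    rwa [hS.mul_comm _ _ hje hs, hsa] at this
  · rw [← hsa] at h
    exact hJ.mem_of_times_unit_mem hS hs hje ht het h

theorem InGenerated.mono {G G' s : V} (h : InGenerated X U ρ W G s) (hG : G ⊆ᵥ G') :
    InGenerated X U ρ W G' s :=
  ⟨h.1, fun J hJ hJG => h.2 J hJ fun g hg => hJG g (hG g hg)⟩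

/-- An ideal over D(f) that contains the images of `G` pulls back to an ideal of `R` containing `G`,
hence containing `gen R G`. -/
theorem IsAffineChart.inGenerated_gen_iff (hX : IsRingedSpace X) (hc : IsAffineChart X U R θ ρ)
    (hR : IsCommRing R) {f G s : V} (hf : f ∈ᵥ R.car) (hG : G ⊆ᵥ R.car) :
    InGenerated X U ρ (dist U θ f) (gen R G) s ↔ InGenerated X U ρ (dist U θ f) G s := by
  refine ⟨fun h => ⟨h.1, fun J hJ hJG => h.2 J hJ fun g hg => ?_⟩, fun h => h.mono (subset_gen hG)⟩
  have hJ' := (hc.isRingHom_dist hf).isIdeal_comap hR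
    (hX.isCommRing _ (hc.openIn_dist hR hf).1) hJ
  exact (mem_sep.1 (gen_subset hJ' (fun g hg => mem_sep.2 ⟨hG g hg, hJG g hg⟩) g hg)).2

/-! ### Contracting the sections of a sheaf of ideals to R -/

section Contraction

variable (hX : IsRingedSpace X) (hc : IsAffineChart X U R θ ρ) (hR : IsCommRing R)
  (hI : IsIdealSheaf X I)
include hX hc hR hI

theorem isIdeal_contraction {f : V} (hf : f ∈ᵥ R.car) :
    IsIdeal R (contraction X U R ρ I (dist U θ f)) :=
  have hD := hc.openIn_dist hR hf
  (hc.isRingHom_dist hf).isIdeal_comap hR (hX.isCommRing _ hD.1)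
    (hI.ideal _ (hX.openIn_pts hD.1))

theorem contraction_mono {W W' : V} (hW : X.OpenIn U W) (hW' : X.OpenIn U W') (h : W' ⊆ᵥ W) :
    contraction X U R ρ I W ⊆ᵥ contraction X U R ρ I W' := fun a ha => by
  obtain ⟨ha, haI⟩ := mem_sep.1 ha
  refine mem_sep.2 ⟨ha, ?_⟩
  rw [← hX.sheaf.restr_restr U W W' _ (hX.openIn_pts hc.isOpen) (hX.openIn_pts hW.1)
    (hX.openIn_pts hW'.1) hW.2 h (hc.ρ_fun.val_mem ha)]
  exact hI.sheaf.restr_mem W W' _ (hX.openIn_pts hW.1) (hX.openIn_pts hW'.1) h haI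

/-- Every ideal of a localization is the extension of its contraction: a section equals, up to a
unit, the image of an element of `R`. -/
theorem inGenerated_contraction_iff {f s : V} (hf : f ∈ᵥ R.car) :
    InGenerated X U ρ (dist U θ f) (contraction X U R ρ I (dist U θ f)) s ↔
      s ∈ᵥ val I (dist U θ f) := by
  have hD := hc.openIn_dist hR hf
  have hId := hI.ideal _ (hX.openIn_pts hD.1)
  refine ⟨fun h => h.2 _ hId fun g hg => (mem_sep.1 hg).2, fun h => ⟨hId.sub s h, fun J hJ hJc => ?_⟩⟩
  obtain ⟨a, ha, hsa⟩ := hc.exists_mem_iff hX hR hf (hId.sub s h)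
  exact (hsa J hJ).2 (hJc a (mem_sep.2 ⟨ha, (hsa _ hId).1 h⟩))

end Contraction

end ZFG

namespace ZFG

variable {V : Type u} [SetUniverse V] [hV : Fact (IsModelZFG0 V)]

/-! ### Finite digraphs -/

/-- In a finitely branching relation without infinite paths, finitely many elements can be reached
from a given one. -/
theorem exists_finite_reachable {A : V} {E : V → V → Prop} [DefPred₂ E]
    (hfin : ∀ x, x ∈ᵥ A → ∃ F, IsFinite F ∧ ∀ y, E x y ↔ y ∈ᵥ F)
    (hwf : ∀ (P : V → Prop) [DefPred₁ P], (∃ x, x ∈ᵥ A ∧ P x) →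
      ∃ x, x ∈ᵥ A ∧ P x ∧ ∀ y, E x y → ¬ P y) {a : V} (ha : a ∈ᵥ A) :
    ∃ N, IsFinite N ∧ N ⊆ᵥ A ∧ a ∈ᵥ N ∧ (∀ x y, x ∈ᵥ N → E x y → y ∈ᵥ N) ∧
      ∀ B, a ∈ᵥ B → (∀ x y, x ∈ᵥ B → E x y → y ∈ᵥ B) → N ⊆ᵥ B := by
  have hE' : ∀ {k : ℕ} (s t : (Fin k → V) → V) [DefFun s] [DefFun t],
    DefPred fun v => E (s v) (t v) := fun s t => DefPred.comp₂ E s t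
  let P : V → V → Prop := fun a N => IsFinite N ∧ N ⊆ᵥ A ∧ a ∈ᵥ N ∧
    (∀ x y, x ∈ᵥ N → E x y → y ∈ᵥ N) ∧
      ∀ B, a ∈ᵥ B → (∀ x y, x ∈ᵥ B → E x y → y ∈ᵥ B) → N ⊆ᵥ B
  have hP₁ : DefPred₁ fun a => ¬ ∃ N, P a N := by
    simp only [P]; infer_instance
  have hP₂ : DefFun₁ fun a => least (P a) a := by
    simp only [P]; infer_instance
  by_contra hcon
  -- `x` is a counterexample none of whose successors is one. The union of the reachable sets
  -- selected for its successors, with `x` added, is a reachable set for `x`.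
  obtain ⟨x, hx, hnot, hsucc⟩ := hwf (fun a => ¬ ∃ N, P a N) ⟨a, ha, hcon⟩
  obtain ⟨F, hF, hxF⟩ := hfin x hx
  have hspec : ∀ y, y ∈ᵥ F → P y (least (P y) y) := fun y hy =>
    have : DefPred₁ (P y) := by simp only [DefPred₁, P]; infer_instance
    least_spec (not_not.1 (hsucc y ((hxF y).2 hy)))
  have hmem : ∀ z, z ∈ᵥ ins (sUnion (img (fun y => least (P y) y) F)) x ↔
      (∃ y, y ∈ᵥ F ∧ z ∈ᵥ least (P y) y) ∨ z = x := fun z => by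
    rw [mem_ins, mem_sUnion]
    simp only [mem_img]
    exact or_congr ⟨fun ⟨_, ⟨y, hy, e⟩, h⟩ => ⟨y, hy, e ▸ h⟩,
      fun ⟨y, hy, h⟩ => ⟨_, ⟨y, hy, rfl⟩, h⟩⟩ Iff.rfl
  refine hnot ⟨ins (sUnion (img (fun y => least (P y) y) F)) x,
    IsFinite.ins (IsFinite.sUnion (hF.img _) fun B hB => ?_) x, fun z hz => ?_,
    (hmem x).2 (Or.inr rfl), fun z w hz hzw => (hmem w).2 (Or.inl ?_), fun B hxB hB z hz => ?_⟩
  · obtain ⟨y, hy, rfl⟩ := mem_img.1 hB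
    exact (hspec y hy).1
  · rcases (hmem z).1 hz with ⟨y, hy, hz⟩ | rfl
    · exact (hspec y hy).2.1 z hz
    · exact hx
  · rcases (hmem z).1 hz with ⟨y, hy, hz⟩ | rfl
    · exact ⟨y, hy, (hspec y hy).2.2.2.1 z w hz hzw⟩
    · exact ⟨w, (hxF w).1 hzw, (hspec w ((hxF w).1 hzw)).2.2.1⟩
  · rcases (hmem z).1 hz with ⟨y, hy, hz⟩ | rfl
    · exact (hspec y hy).2.2.2.2 B (hB x y hxB ((hxF y).2 hy)) hB z hz
    · exact hxB

/-- A definable subset of a Noetherian ring lies in the ideal generated by a finite subset. -/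
theorem IsNoetherianRing.exists_finite_gen {R : RingData V} (hR : IsNoetherianRing R)
    (P : V → Prop) [DefPred₁ P] (hP : ∀ f, P f → f ∈ᵥ R.car) :
    ∃ F, IsFinite F ∧ (∀ f, f ∈ᵥ F → P f) ∧ ∀ f, P f → f ∈ᵥ gen R F := by
  have : ∀ {k : ℕ} (s : (Fin k → V) → V) [DefFun s], DefPred fun v => P (s v) :=
    fun s => DefPred.comp₁ P s
  -- Once the ideal generated by finitely many elements of the class is maximal, adjoining another
  -- element does not enlarge it.
  obtain ⟨_, ⟨F, hF, hFP, rfl⟩, hmax⟩ := hR.exists_maximal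
    (fun J => ∃ F, IsFinite F ∧ (∀ f, f ∈ᵥ F → P f) ∧ J = gen R F)
    (by rintro _ ⟨F, -, -, rfl⟩; exact isIdeal_gen hR.1 F)
    ⟨_, emp V, isFinite_emp, fun f hf => (notMem_emp hf).elim, rfl⟩
  refine ⟨F, hF, hFP, fun f hf => ?_⟩
  have hP' : ∀ g, g ∈ᵥ ins F f → P g := fun g hg => by
    rcases mem_ins.1 hg with hg | rfl
    exacts [hFP g hg, hf]
  have hsub : ins F f ⊆ᵥ gen R (ins F f) := subset_gen fun g hg => hP g (hP' g hg)
  rw [← hmax (gen R (ins F f)) ⟨_, hF.ins f, hP', rfl⟩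
    (gen_subset (isIdeal_gen hR.1 _) fun g hg => hsub g (mem_ins.2 (Or.inl hg)))]
  exact hsub f (mem_ins.2 (Or.inr rfl))

/-! ### Jumps of a sheaf of ideals and the digraph they span -/

section Digraph

variable {X : RingedSpace V} {U : V} {R : RingData V} {θ ρ I : V}

variable (X U R θ ρ I) in
/-- Over the distinguished open set `D(f)` in `W` there is a section of `I` that does not come from
the sections over `W`. -/
def IsJump (W f : V) : Prop := f ∈ᵥ R.car ∧ dist U θ f ⊆ᵥ W ∧
  ∃ s, s ∈ᵥ val I (dist U θ f) ∧
    ¬ InGenerated X U ρ (dist U θ f) (contraction X U R ρ I W) s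

instance DefPred.isJump {k : ℕ} {s t : (Fin k → V) → V} [DefFun s] [DefFun t] :
    DefPred fun v => IsJump X U R θ ρ I (s v) (t v) :=
  have : DefPred₂ (IsJump X U R θ ρ I) := by simp only [DefPred₂, IsJump]; infer_instance
  DefPred.comp₂ (IsJump X U R θ ρ I) s t

variable (X U R θ ρ I) in
/-- A finite set of elements `f` with a jump from `W` to `D(f)`, such that these `D(f)` cover all
jumps from `W`. -/
noncomputable def jumps (W : V) : V :=
  least (fun F => IsFinite F ∧ (∀ f, f ∈ᵥ F → IsJump X U R θ ρ I W f) ∧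
    ∀ f, IsJump X U R θ ρ I W f → f ∈ᵥ gen R F) W

variable (X U R ρ I) in
/-- A finite set of generators of the sections of `I` over `W`. -/
noncomputable def generators (W : V) : V :=
  least (fun G => IsFinite G ∧ G ⊆ᵥ R.car ∧ gen R G = contraction X U R ρ I W) W

instance DefFun.jumps {k : ℕ} {s : (Fin k → V) → V} [DefFun s] :
    DefFun fun v => jumps X U R θ ρ I (s v) :=
  have : DefFun₁ (ZFG.jumps X U R θ ρ I) := by simp only [DefFun₁, ZFG.jumps]; infer_instance
  DefFun.comp₁ (ZFG.jumps X U R θ ρ I) s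

instance DefFun.generators {k : ℕ} {s : (Fin k → V) → V} [DefFun s] :
    DefFun fun v => generators X U R ρ I (s v) :=
  have : DefFun₁ (ZFG.generators X U R ρ I) := by
    simp only [DefFun₁, ZFG.generators]; infer_instance
  DefFun.comp₁ (ZFG.generators X U R ρ I) s

theorem IsNoetherianRing.jumps_spec (hR : IsNoetherianRing R) (W : V) :
    IsFinite (jumps X U R θ ρ I W) ∧
    (∀ f, f ∈ᵥ jumps X U R θ ρ I W → IsJump X U R θ ρ I W f) ∧
    ∀ f, IsJump X U R θ ρ I W f → f ∈ᵥ gen R (jumps X U R θ ρ I W) :=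
  least_spec (P := fun F => IsFinite F ∧ (∀ f, f ∈ᵥ F → IsJump X U R θ ρ I W f) ∧
    ∀ f, IsJump X U R θ ρ I W f → f ∈ᵥ gen R F)
    (hR.exists_finite_gen (IsJump X U R θ ρ I W) fun _ hf => hf.1)

/-- The jumps from `W` are covered by the distinguished open sets of `jumps W`. -/
theorem IsJump.exists_mem_jumps (hR : IsNoetherianRing R) (hc : IsAffineChart X U R θ ρ)
    {W f x : V} (hf : IsJump X U R θ ρ I W f) (hx : x ∈ᵥ dist U θ f) :
    ∃ g, g ∈ᵥ jumps X U R θ ρ I W ∧ x ∈ᵥ dist U θ g := by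
  obtain ⟨hxU, hfx⟩ := mem_dist.1 hx
  by_contra! h
  refine hfx (gen_subset (hc.θ_prime x hxU).ideal (fun g hg => ?_) f ((hR.jumps_spec W).2.2 f hf))
  by_contra hgx
  exact h g hg (mem_dist.2 ⟨hxU, hgx⟩)

section Noetherian

variable (hX : IsRingedSpace X) (hR : IsNoetherianRing R) (hc : IsAffineChart X U R θ ρ)
  (hI : IsIdealSheaf X I)
include hX hR hc hI

theorem generators_spec {f : V} (hf : f ∈ᵥ R.car) :
    IsFinite (generators X U R ρ I (dist U θ f)) ∧
    generators X U R ρ I (dist U θ f) ⊆ᵥ R.car ∧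
    gen R (generators X U R ρ I (dist U θ f)) = contraction X U R ρ I (dist U θ f) :=
  least_spec (P := fun G => IsFinite G ∧ G ⊆ᵥ R.car ∧
    gen R G = contraction X U R ρ I (dist U θ f))
    (hR.exists_gen_eq (isIdeal_contraction hX hc hR.1 hI hf))

theorem inGenerated_generators_iff {f g s : V} (hf : f ∈ᵥ R.car) (hg : g ∈ᵥ R.car) :
    InGenerated X U ρ (dist U θ g) (generators X U R ρ I (dist U θ f)) s ↔
      InGenerated X U ρ (dist U θ g) (contraction X U R ρ I (dist U θ f)) s := by
  obtain ⟨-, hG, hgen⟩ := generators_spec hX hR hc hI hf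
  rw [← hgen, hc.inGenerated_gen_iff hX hR.1 hg hG]

/-- The open set D(f) is chosen with the largest contraction among those satisfying `P`. A jump from
D(f) strictly enlarges the contraction, so it must leave `P`. This serves both for the absence of
infinite paths and for finding the last node around a point. -/
theorem exists_terminal (P : V → Prop) [DefPred₁ P] (hne : ∃ f, f ∈ᵥ R.car ∧ P (dist U θ f)) :
    ∃ f, f ∈ᵥ R.car ∧ P (dist U θ f) ∧
      ∀ g, IsJump X U R θ ρ I (dist U θ f) g → ¬ P (dist U θ g) := by
  have : ∀ {k : ℕ} (s : (Fin k → V) → V) [DefFun s], DefPred fun v => P (s v) :=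
    fun s => DefPred.comp₁ P s
  obtain ⟨f₀, hf₀, hP₀⟩ := hne
  obtain ⟨_, ⟨f, hf, hP, rfl⟩, hmax⟩ := hR.exists_maximal
    (fun J => ∃ f, f ∈ᵥ R.car ∧ P (dist U θ f) ∧ J = contraction X U R ρ I (dist U θ f))
    (by rintro _ ⟨f, hf, -, rfl⟩; exact isIdeal_contraction hX hc hR.1 hI hf)
    ⟨_, f₀, hf₀, hP₀, rfl⟩
  refine ⟨f, hf, hP, fun g hg hPg => ?_⟩
  obtain ⟨hgR, hgf, s, hs, hsn⟩ := hg
  have hle := contraction_mono hX hc hR.1 hI (hc.openIn_dist hR.1 hf) (hc.openIn_dist hR.1 hgR) hgf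
  rw [← hmax _ ⟨g, hgR, hPg, rfl⟩ hle] at hsn
  exact hsn ((inGenerated_contraction_iff hX hc hR.1 hI hgR).2 hs)

/-- A sheaf of ideals that contains the generators over the members of a set of distinguished open
sets closed under jumps contains `I`. -/
theorem subset_of_generators_mem {N J : V} (hU : U ∈ᵥ N)
    (hNE : ∀ W f, W ∈ᵥ N → f ∈ᵥ jumps X U R θ ρ I W → dist U θ f ∈ᵥ N)
    (hJ : IsIdealSheafOn X U J)
    (hNJ : ∀ W g, W ∈ᵥ N → g ∈ᵥ generators X U R ρ I W → restr X.res U W (val ρ g) ∈ᵥ val J W)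
    {W : V} (hW : X.OpenIn U W) : val I W ⊆ᵥ val J W := by
  intro s hs
  have hsX := (hI.ideal W (hX.openIn_pts hW.1)).sub s hs
  have hSiff : ∀ D, D ∈ᵥ sep (fun D => (D ⊆ᵥ W) ∧ restr X.res W D s ∈ᵥ val J D)
      (img (dist U θ) R.car) ↔
      (∃ f, f ∈ᵥ R.car ∧ D = dist U θ f) ∧ (D ⊆ᵥ W) ∧ restr X.res W D s ∈ᵥ val J D :=
    fun D => by rw [mem_sep, mem_img]
  -- The covering consists of all distinguished opens in `W` over which `s` already lies in `J`;
  -- what has to be shown is that they reach every point.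
  refine hJ.mem_of_locally_mem hX (S := sep (fun D => (D ⊆ᵥ W) ∧ restr X.res W D s ∈ᵥ val J D)
    (img (dist U θ) R.car)) hW hsX ⟨fun D hD => ?_, fun x => ⟨fun hx => ?_, ?_⟩⟩ fun D hD => ?_
  · obtain ⟨⟨f, hf, rfl⟩, -⟩ := (hSiff D).1 hD
    exact hc.openIn_dist hR.1 hf
  -- D(f) is a node around `x` from which no jump leads to another node around `x`; the root ensures
  -- that there is some node around `x`.
  · obtain ⟨f, hf, ⟨hfN, hxf⟩, hterm⟩ := exists_terminal hX hR hc hI (fun D => D ∈ᵥ N ∧ x ∈ᵥ D)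
      ⟨R.one, hR.1.one_mem, by rw [hc.dist_one]; exact ⟨hU, hW.2 x hx⟩⟩
    have hDf := hc.openIn_dist hR.1 hf
    obtain ⟨h, hh, hxh, hhsub⟩ := hc.exists_dist_subset (W := inter W (dist U θ f))
      ⟨hX.inter_mem hW.1 hDf.1, fun y hy => hW.2 y (mem_inter.1 hy).1⟩ (mem_inter.2 ⟨hx, hxf⟩)
    have hDh := hc.openIn_dist hR.1 hh
    have hhW : dist U θ h ⊆ᵥ W := fun y hy => (mem_inter.1 (hhsub y hy)).1
    have hhf : dist U θ h ⊆ᵥ dist U θ f := fun y hy => (mem_inter.1 (hhsub y hy)).2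
    have hsI := hI.sheaf.restr_mem W _ s (hX.openIn_pts hW.1) (hX.openIn_pts hDh.1) hhW hs
    have hsgen : InGenerated X U ρ (dist U θ h) (generators X U R ρ I (dist U θ f))
        (restr X.res W (dist U θ h) s) := by
      rw [inGenerated_generators_iff hX hR hc hI hf hh]
      -- Otherwise D(h) would be a jump from D(f), and one of the selected jumps would be a further
      -- node containing `x`.
      by_contra hn
      obtain ⟨g, hg, hxg⟩ := IsJump.exists_mem_jumps (I := I) hR hc ⟨hh, hhf, _, hsI, hn⟩ hxh
      exact hterm g ((hR.jumps_spec _).2.1 g hg) ⟨hNE _ g hfN hg, hxg⟩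
    refine ⟨dist U θ h, (hSiff _).2 ⟨⟨h, hh, rfl⟩, hhW, hsgen.2 _ (hJ.ideal _ hDh) fun g hg => ?_⟩,
      hxh⟩
    rw [← hX.sheaf.restr_restr U (dist U θ f) (dist U θ h) _ (hX.openIn_pts hc.isOpen)
      (hX.openIn_pts hDf.1) (hX.openIn_pts hDh.1) hDf.2 hhf
      (hc.ρ_fun.val_mem ((generators_spec hX hR hc hI hf).2.1 g hg))]
    exact hJ.sheaf.restr_mem _ _ _ hDf hDh hhf (hNJ _ g hfN hg)
  · rintro ⟨D, hD, hx⟩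
    exact ((hSiff D).1 hD).2.1 x hx
  · exact ((hSiff D).1 hD).2.2

/-- The open sets of the nodes of the digraph. -/
theorem exists_nodes : ∃ N, IsFinite N ∧ (∀ W, W ∈ᵥ N → ∃ f, f ∈ᵥ R.car ∧ W = dist U θ f) ∧
    U ∈ᵥ N ∧ (∀ W f, W ∈ᵥ N → f ∈ᵥ jumps X U R θ ρ I W → dist U θ f ∈ᵥ N) ∧
    ∀ B, U ∈ᵥ B → (∀ W f, W ∈ᵥ B → f ∈ᵥ jumps X U R θ ρ I W → dist U θ f ∈ᵥ B) → N ⊆ᵥ B := by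
  have hA : ∀ W, W ∈ᵥ img (dist U θ) R.car ↔ ∃ f, f ∈ᵥ R.car ∧ W = dist U θ f := fun _ => mem_img
  obtain ⟨N, hN, hNA, hUN, hcl, hmin⟩ := exists_finite_reachable (A := img (dist U θ) R.car)
    (E := fun W D => ∃ f, f ∈ᵥ jumps X U R θ ρ I W ∧ D = dist U θ f) (a := U)
    (fun W _ => ⟨img (dist U θ) (jumps X U R θ ρ I W), (hR.jumps_spec W).1.img _,
      fun D => mem_img.symm⟩)
    (by
      rintro P _ ⟨W, hW, hP⟩
      obtain ⟨f₀, hf₀, rfl⟩ := (hA W).1 hW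
      obtain ⟨f, hf, hPf, hterm⟩ := exists_terminal hX hR hc hI P ⟨f₀, hf₀, hP⟩
      refine ⟨_, (hA _).2 ⟨f, hf, rfl⟩, hPf, ?_⟩
      rintro _ ⟨g, hg, rfl⟩
      exact hterm g ((hR.jumps_spec _).2.1 g hg))
    ((hA U).2 ⟨R.one, hR.1.one_mem, hc.dist_one.symm⟩)
  refine ⟨N, hN, fun W hW => (hA W).1 (hNA W hW), hUN,
    fun W f hW hf => hcl W _ hW ⟨f, hf, rfl⟩, fun B hUB hB => hmin B hUB ?_⟩
  rintro W _ hW ⟨f, hf, rfl⟩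
  exact hB W f hW hf

/-- Every sheaf of ideals is generated by a finite digraph over a Noetherian affine open set. -/
theorem exists_isFiniteDigraphFor : ∃ N E r, IsFiniteDigraphFor X I U R θ ρ N E r := by
  obtain ⟨N, hN, hNdist, hUN, hcl, hmin⟩ := exists_nodes hX hR hc hI
  let node : V → V := fun W => pair W (generators X U R ρ I W)
  have hnode : DefFun₁ node := inferInstance
  have hmemN : ∀ W G, pair W G ∈ᵥ img node N ↔ W ∈ᵥ N ∧ G = generators X U R ρ I W := fun W G => by
    rw [mem_img]
    simp only [node, pair_inj]
    exact ⟨fun ⟨W', h, e, e'⟩ => by subst e; exact ⟨h, e'⟩, fun ⟨h, e⟩ => ⟨W, h, rfl, e⟩⟩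
  obtain ⟨E, hE⟩ : ∃ E, ∀ e, e ∈ᵥ E ↔ ∃ W f, W ∈ᵥ N ∧ f ∈ᵥ jumps X U R θ ρ I W ∧
      e = pair (node W) (node (dist U θ f)) := by
    refine ⟨sep (fun e => ∃ W f, W ∈ᵥ N ∧ f ∈ᵥ jumps X U R θ ρ I W ∧
      e = pair (node W) (node (dist U θ f))) (prod (img node N) (img node N)), fun e => ?_⟩
    rw [mem_sep, and_iff_right_iff_imp]
    rintro ⟨W, f, hW, hf, rfl⟩
    exact mem_prod.2 ⟨_, _, mem_img.2 ⟨W, hW, rfl⟩, mem_img.2 ⟨_, hcl W f hW hf, rfl⟩, rfl⟩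
  have hEpair : ∀ W G W' G', pair (pair W G) (pair W' G') ∈ᵥ E → ∃ h f, h ∈ᵥ R.car ∧
      IsJump X U R θ ρ I W f ∧ W = dist U θ h ∧ W' = dist U θ f ∧
      G = generators X U R ρ I W ∧ G' = generators X U R ρ I W' := by
    intro W G W' G' h
    obtain ⟨W₁, f, hW₁, hf, e⟩ := (hE _).1 h
    simp only [node, pair_inj] at e
    obtain ⟨⟨rfl, rfl⟩, rfl, rfl⟩ := e
    obtain ⟨g, hg, rfl⟩ := hNdist W hW₁
    exact ⟨g, f, hg, (hR.jumps_spec _).2.1 f hf, rfl, rfl, rfl, rfl⟩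
  refine ⟨img node N, E, node U, hR, hc, hN.img node, ?_, ?_⟩
  · exact {
      node := fun n hn => by
        obtain ⟨W, hW, rfl⟩ := mem_img.1 hn
        obtain ⟨f, hf, rfl⟩ := hNdist W hW
        obtain ⟨hfin, hsub, -⟩ := generators_spec hX hR hc hI hf
        exact ⟨_, _, rfl, ⟨f, hf, isDistinguished_dist U θ f⟩, hfin, hsub⟩
      edge := fun e he => by
        obtain ⟨W, f, hW, hf, rfl⟩ := (hE e).1 he
        exact ⟨_, _, mem_img.2 ⟨W, hW, rfl⟩, mem_img.2 ⟨_, hcl W f hW hf, rfl⟩, rfl⟩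
      root_mem := mem_img.2 ⟨U, hUN, rfl⟩
      reachable := fun A hr hA n hn => by
        obtain ⟨W, hW, rfl⟩ := mem_img.1 hn
        -- Reachability in the graph is the minimality of `N`, applied to the opens in `N` whose
        -- node lies in `A`.
        refine (mem_sep.1 (hmin (sep (fun W => node W ∈ᵥ A) N) (mem_sep.2 ⟨hUN, hr⟩)
          (fun W f hW hf => ?_) W hW)).2
        obtain ⟨hW, hWA⟩ := mem_sep.1 hW
        exact mem_sep.2 ⟨hcl W f hW hf, hA _ _ hWA ((hE _).2 ⟨W, f, hW, hf, rfl⟩)⟩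
      global := ⟨_, rfl⟩
      functional := fun W G G' h h' => ((hmemN W G).1 h).2.trans ((hmemN W G').1 h').2.symm
      decreasing := fun W G W' G' h => by
        obtain ⟨g, f, -, ⟨hf, hsub, s, hs, hsn⟩, rfl, rfl, -⟩ := hEpair W G W' G' h
        -- If the two opens were equal, the contraction over the first would already generate the
        -- section witnessing the jump.
        refine ⟨hsub, fun e => hsn ?_⟩
        rw [← e, inGenerated_contraction_iff hX hc hR.1 hI hf]
        exact hs
      increasing := fun W G W' G' h => by
        obtain ⟨g, f, hg, ⟨hf, hsub, s, hs, hsn⟩, rfl, rfl, rfl, rfl⟩ := hEpair W G W' G' h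
        simp only [inGenerated_generators_iff hX hR hc hI hg hf,
          inGenerated_generators_iff hX hR hc hI hf hf]
        exact ⟨fun t ht => ht.mono (contraction_mono hX hc hR.1 hI (hc.openIn_dist hR.1 hg)
            (hc.openIn_dist hR.1 hf) hsub),
          s, (inGenerated_contraction_iff hX hc hR.1 hI hf).2 hs, hsn⟩ }
  · refine ⟨fun W G g hn hg => ?_, fun J hJ hJN W hW => ?_⟩
    · obtain ⟨hW, rfl⟩ := (hmemN W G).1 hn
      obtain ⟨f, hf, rfl⟩ := hNdist W hW
      obtain ⟨-, hsub, hgen⟩ := generators_spec hX hR hc hI hf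
      have := subset_gen hsub g hg
      rw [hgen] at this
      exact (mem_sep.1 this).2
    · exact subset_of_generators_mem hX hR hc hI hUN hcl hJ
        (fun W g hW hg => hJN W _ g ((hmemN W _).2 ⟨hW, rfl⟩) hg) hW

end Noetherian

end Digraph

end ZFG

namespace ZFG

variable {V : Type u} [SetUniverse V]

/-! ### Sheaves of ideals are finitely generated, and the sets of module maps -/

noncomputable def fst (p : V) : V := the (fun x => ∃ y, p = pair x y) p

noncomputable def snd (p : V) : V := the (fun y => ∃ x, p = pair x y) p

/-- `I` is the smallest sheaf of ideals that contains the sections `s` over `W` for the pairs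
`(W, s)` in `K`. -/
def IsGeneratedBy (X : RingedSpace V) (I K : V) : Prop :=
  (∀ p, p ∈ᵥ K → ∃ W s, W ∈ᵥ X.opens ∧ s ∈ᵥ val I W ∧ p = pair W s) ∧
  ∀ J, IsIdealSheaf X J → (∀ W s, pair W s ∈ᵥ K → s ∈ᵥ val J W) →
    ∀ W, W ∈ᵥ X.opens → val I W ⊆ᵥ val J W

section Definability

variable {k : ℕ} {s t : (Fin k → V) → V}

instance DefFun.fst [DefFun s] : DefFun fun v => fst (s v) :=
  have : DefFun₁ (ZFG.fst (V := V)) := by simp only [DefFun₁, ZFG.fst]; infer_instance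
  DefFun.comp₁ ZFG.fst s

instance DefFun.snd [DefFun s] : DefFun fun v => snd (s v) :=
  have : DefFun₁ (ZFG.snd (V := V)) := by simp only [DefFun₁, ZFG.snd]; infer_instance
  DefFun.comp₁ ZFG.snd s

instance DefPred.isGeneratedBy (X : RingedSpace V) [DefFun s] [DefFun t] :
    DefPred fun v => IsGeneratedBy X (s v) (t v) :=
  have : DefPred₂ (IsGeneratedBy X) := by simp only [DefPred₂, IsGeneratedBy]; infer_instance
  DefPred.comp₂ (IsGeneratedBy X) s t

end Definability

variable [hV : Fact (IsModelZFG0 V)]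
variable {X : RingedSpace V} {U W I J : V} {M : ModuleSheaf V}

@[simp] theorem fst_pair (x y : V) : fst (pair x y) = x :=
  the_eq ⟨y, rfl⟩ fun _ ⟨_, h⟩ => (pair_inj.1 h).1.symm

@[simp] theorem snd_pair (x y : V) : snd (pair x y) = y :=
  the_eq ⟨x, rfl⟩ fun _ ⟨_, h⟩ => (pair_inj.1 h).2.symm

/-- The restriction of a sheaf of ideals to an open set. -/
theorem IsIdealSheaf.exists_restriction (hX : IsRingedSpace X) (hJ : IsIdealSheaf X J) (U : V) :
    ∃ J', IsIdealSheafOn X U J' ∧ ∀ W, X.OpenIn U W → val J' W = val J W := by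
  obtain ⟨J', hJ', h⟩ := exists_family X U (fun W => val J W)
  refine ⟨J', isIdealSheafOn_of_local hX hJ' (fun W hW => ?_) (fun W N s hW hN hNW hs => ?_)
    (fun W S s hW hS hs hloc => ?_), h⟩
  · rw [h W hW]
    exact hJ.ideal W (hX.openIn_pts hW.1)
  · rw [h W hW] at hs
    rw [h N hN]
    exact hJ.sheaf.restr_mem W N s (hX.openIn_pts hW.1) (hX.openIn_pts hN.1) hNW hs
  · rw [h W hW]
    exact hJ.mem_of_locally_mem hX (hX.openIn_pts hW.1) hs (hX.cover_pts hS) fun N hN =>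
      h N (hS.1 N hN) ▸ hloc N hN

/-- The generators of the digraph, which are elements of `R` attached to nodes, become pairs of an
open set and a section. In this form the data for several charts can be united. -/
theorem exists_local_generators (hX : IsRingedSpace X) {R : RingData V} {θ ρ : V}
    (hR : IsNoetherianRing R) (hc : IsAffineChart X U R θ ρ) (hI : IsIdealSheaf X I) :
    ∃ K, IsFinite K ∧ (∀ p, p ∈ᵥ K → ∃ W s, W ∈ᵥ X.opens ∧ s ∈ᵥ val I W ∧ p = pair W s) ∧
      ∀ J, IsIdealSheaf X J → (∀ W s, pair W s ∈ᵥ K → s ∈ᵥ val J W) →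
        ∀ W, X.OpenIn U W → val I W ⊆ᵥ val J W := by
  obtain ⟨N, E, r, -, -, hN, hdig, hgen⟩ := exists_isFiniteDigraphFor hX hR hc hI
  let t : V → V := fun n => img (fun g => pair (fst n) (restr X.res U (fst n) (val ρ g))) (snd n)
  have ht : DefFun₁ t := by simp only [t]; infer_instance
  have hmem : ∀ p, p ∈ᵥ sUnion (img t N) ↔
      ∃ W G g, pair W G ∈ᵥ N ∧ g ∈ᵥ G ∧ p = pair W (restr X.res U W (val ρ g)) := by
    intro p
    simp only [mem_sUnion, mem_img]
    constructor
    · rintro ⟨_, ⟨n, hn, rfl⟩, hp⟩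
      obtain ⟨g, hg, rfl⟩ := mem_img.1 hp
      obtain ⟨W, G, rfl, -⟩ := hdig.node n hn
      rw [snd_pair] at hg
      exact ⟨W, G, g, hn, hg, by rw [fst_pair]⟩
    · rintro ⟨W, G, g, hn, hg, rfl⟩
      exact ⟨_, ⟨_, hn, rfl⟩, mem_img.2 ⟨g, by rwa [snd_pair], by rw [fst_pair]⟩⟩
  refine ⟨sUnion (img t N), (hN.img t).sUnion fun B hB => ?_, fun p hp => ?_,
    fun J hJ hKJ W hW => ?_⟩
  · obtain ⟨n, hn, rfl⟩ := mem_img.1 hB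
    obtain ⟨W, G, rfl, -, hG, -⟩ := hdig.node n hn
    refine IsFinite.img ?_ _
    rwa [snd_pair]
  · obtain ⟨W, G, g, hn, hg, rfl⟩ := (hmem p).1 hp
    exact ⟨W, _, (hdig.openIn_of_node hR hc hn).1, hgen.1 W G g hn hg, rfl⟩
  -- The minimality of `I` over `U` concerns families indexed by the opens in `U`, so `J` is
  -- restricted first.
  · obtain ⟨J', hJ', h⟩ := hJ.exists_restriction hX U
    rw [← h W hW]
    refine hgen.2 J' hJ' (fun W G g hn hg => ?_) W hW
    rw [h W (hdig.openIn_of_node hR hc hn)]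
    exact hKJ _ _ ((hmem _).2 ⟨W, G, g, hn, hg, rfl⟩)

/-- On a Noetherian scheme every sheaf of ideals is generated by finitely many sections. -/
theorem IsNoetherianScheme.exists_isGeneratedBy (hX : IsNoetherianScheme X)
    (hI : IsIdealSheaf X I) : ∃ K, IsFinite K ∧ IsGeneratedBy X I K := by
  obtain ⟨hX, C, hC, hcov, haff⟩ := hX
  -- `least` selects one generating set for each member of the covering, so that replacement can
  -- collect them.
  let P : V → V → Prop := fun U K => IsFinite K ∧
    (∀ p, p ∈ᵥ K → ∃ W s, W ∈ᵥ X.opens ∧ s ∈ᵥ val I W ∧ p = pair W s) ∧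
      ∀ J, IsIdealSheaf X J → (∀ W s, pair W s ∈ᵥ K → s ∈ᵥ val J W) →
        ∀ W, X.OpenIn U W → val I W ⊆ᵥ val J W
  have hP : DefFun₁ fun U => least (P U) U := by simp only [P]; infer_instance
  have hspec : ∀ U, U ∈ᵥ C → P U (least (P U) U) := fun U hU => by
    have : DefPred₁ (P U) := by simp only [DefPred₁, P]; infer_instance
    obtain ⟨R, θ, ρ, hR, hc⟩ := haff U hU
    exact least_spec (exists_local_generators hX hR hc hI)
  have hmem : ∀ p, p ∈ᵥ sUnion (img (fun U => least (P U) U) C) ↔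
      ∃ U, U ∈ᵥ C ∧ p ∈ᵥ least (P U) U := fun p => by
    rw [mem_sUnion]
    simp only [mem_img]
    exact ⟨fun ⟨_, ⟨U, hU, e⟩, h⟩ => ⟨U, hU, e ▸ h⟩, fun ⟨U, hU, h⟩ => ⟨_, ⟨U, hU, rfl⟩, h⟩⟩
  refine ⟨sUnion (img (fun U => least (P U) U) C), (hC.img _).sUnion fun B hB => ?_,
    fun p hp => ?_, fun J hJ hKJ W hW s hs => ?_⟩
  · obtain ⟨U, hU, rfl⟩ := mem_img.1 hB
    exact (hspec U hU).1
  · obtain ⟨U, hU, hp⟩ := (hmem p).1 hp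
    exact (hspec U hU).2.1 p hp
  · have hWX := hX.openIn_pts hW
    refine hJ.mem_of_locally_mem hX hWX ((hI.ideal W hWX).sub s hs) (hcov.inter hX hW)
      fun N hN => ?_
    obtain ⟨U, hU, rfl⟩ := mem_img.1 hN
    have hN := hX.inter_mem hW (hcov.1 U hU).1
    exact (hspec U hU).2.2 J hJ (fun W s h => hKJ W s ((hmem _).2 ⟨U, hU, h⟩)) _
      ⟨hN, fun x hx => (mem_inter.1 hx).2⟩ _
      (hI.sheaf.restr_mem W _ s hWX (hX.openIn_pts hN) (fun x hx => (mem_inter.1 hx).1) hs)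

/-- Module maps that agree on a set of generators are equal. -/
theorem IsGeneratedBy.eq_of_agree (hX : IsRingedSpace X) (hM : IsModuleSheaf X M)
    (hI : IsIdealSheaf X I) {K φ ψ : V} (hK : IsGeneratedBy X I K) (hφ : IsModuleMap X I M φ)
    (hψ : IsModuleMap X I M ψ)
    (h : ∀ W s, pair W s ∈ᵥ K → val (val φ W) s = val (val ψ W) s) : φ = ψ := by
  obtain ⟨J, hJ, hmem⟩ := exists_equalizer hX hM hI hφ hψ X.pts
  refine hφ.family.ext hψ.family fun W hW => hφ.val_eq_val hψ hW fun s hs =>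
    ((hmem W (hX.openIn_pts hW) s).1 (hK.2 J hJ (fun W s hWs => ?_) W hW s hs)).2
  obtain ⟨W', s', hW', hs', e⟩ := hK.1 _ hWs
  obtain ⟨rfl, rfl⟩ := pair_inj.1 e
  exact (hmem W (hX.openIn_pts hW') s).2 ⟨hs', h W s hWs⟩

/-- The table `values φ` is a finite subset of K × ⋃ M(W) and determines φ. Replacement is applied
to the partial inverse, from tables to maps, because only the tables are known to lie in a set. -/
theorem IsNoetherianScheme.exists_homSet (hX : IsNoetherianScheme X) (hM : IsModuleSheaf X M)
    (hI : IsIdealSheaf X I) : ∃ h, IsHomSet X I M h := by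
  obtain ⟨K, hKfin, hK⟩ := hX.exists_isGeneratedBy hI
  let values : V → V := fun φ => img (fun p => pair p (val (val φ (fst p)) (snd p))) K
  have hvalues : DefFun₁ values := by simp only [values]; infer_instance
  have hmem : ∀ φ W s m, pair (pair W s) m ∈ᵥ values φ ↔
      pair W s ∈ᵥ K ∧ m = val (val φ W) s := fun φ W s m => by
    simp only [values, mem_img, pair_inj]
    constructor
    · rintro ⟨p, hp, rfl, rfl⟩
      exact ⟨hp, by rw [fst_pair, snd_pair]⟩
    · rintro ⟨hp, rfl⟩
      exact ⟨_, hp, rfl, by rw [fst_pair, snd_pair]⟩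
  have : DefPred₂ fun d φ => IsModuleMap X I M φ ∧ d = values φ := by
    simp only [DefPred₂, values]; infer_instance
  obtain ⟨h, hh⟩ := exists_rel_image (F := fun d φ => IsModuleMap X I M φ ∧ d = values φ)
    (finSub (prod K (sUnion (img (fun W => val M.car W) X.opens)))) (by
      rintro d φ ψ - ⟨hφ, rfl⟩ ⟨hψ, e⟩
      refine hK.eq_of_agree hX.1 hM hI hφ hψ fun W s hWs => ?_
      exact ((hmem ψ W s _).1 (e ▸ (hmem φ W s _).2 ⟨hWs, rfl⟩)).2)
  refine ⟨h, fun φ => (hh φ).trans ⟨fun ⟨_, _, hφ, _⟩ => hφ, fun hφ =>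
    ⟨values φ, mem_finSub.2 ⟨hKfin.img _, fun q hq => ?_⟩, hφ, rfl⟩⟩⟩
  obtain ⟨p, hp, rfl⟩ := mem_img.1 hq
  obtain ⟨W, s, hW, hs, rfl⟩ := hK.1 p hp
  rw [fst_pair, snd_pair]
  exact mem_prod.2 ⟨_, _, hp, mem_sUnion.2
    ⟨_, mem_img.2 ⟨W, hW, rfl⟩, (hφ.isFun W hW).val_mem hs⟩, rfl⟩

/-- The sheaves of ideals of a Noetherian scheme form a set. -/
theorem IsNoetherianScheme.exists_idealSheaves (hX : IsNoetherianScheme X) :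
    ∃ S, ∀ I, I ∈ᵥ S ↔ IsIdealSheaf X I := by
  -- Two sheaves of ideals generated by the same set of pairs contain each other, so the relation
  -- from generating sets to sheaves is functional.
  obtain ⟨S, hS⟩ := exists_rel_image (F := fun K I => IsIdealSheaf X I ∧ IsGeneratedBy X I K)
    (finSub (prod X.opens (sUnion (img (fun W => val X.car W) X.opens)))) (by
      rintro K I J - ⟨hI, hIK⟩ ⟨hJ, hJK⟩
      have hle : ∀ I J, IsGeneratedBy X I K → IsGeneratedBy X J K → IsIdealSheaf X J →
          ∀ W, W ∈ᵥ X.opens → val I W ⊆ᵥ val J W := fun I J hI hJ hJ' =>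
        hI.2 J hJ' fun W s h => by
          obtain ⟨W', s', -, hs, e⟩ := hJ.1 _ h
          obtain ⟨rfl, rfl⟩ := pair_inj.1 e
          exact hs
      exact hI.family.ext hJ.family fun W hW =>
        (hle I J hIK hJK hJ W hW.1).antisymm (hle J I hJK hIK hI W hW.1))
  refine ⟨S, fun I => (hS I).trans ⟨fun ⟨_, _, hI, _⟩ => hI, fun hI => ?_⟩⟩
  obtain ⟨K, hKfin, hK⟩ := hX.exists_isGeneratedBy hI
  refine ⟨K, mem_finSub.2 ⟨hKfin, fun p hp => ?_⟩, hI, hK⟩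
  obtain ⟨W, s, hW, hs, rfl⟩ := hK.1 p hp
  exact mem_prod.2 ⟨W, s, hW, mem_sUnion.2 ⟨_, mem_img.2 ⟨W, hW, rfl⟩,
    (hI.ideal W (hX.1.openIn_pts hW)).sub s hs⟩, rfl⟩

/-- By extensionality each sheaf of ideals has at most one set of maps, so replacement over the set
of sheaves of ideals applies. -/
theorem IsNoetherianScheme.exists_homSets (hX : IsNoetherianScheme X) (M : ModuleSheaf V) :
    ∃ H, ∀ h, h ∈ᵥ H ↔ ∃ I, IsIdealSheaf X I ∧ IsHomSet X I M h := by
  obtain ⟨S, hS⟩ := hX.exists_idealSheaves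
  obtain ⟨H, hH⟩ := exists_rel_image (F := fun I h => IsHomSet X I M h) S
    fun I h h' _ hh hh' => set_ext fun φ => (hh φ).trans (hh' φ).symm
  exact ⟨H, fun h => by simp only [hH, hS]⟩

end ZFG

theorem theoremT {V : Type u} [SetUniverse V] (hV : ZFG.IsModelZFG0 V)
    (X : ZFG.RingedSpace V) (hX : ZFG.IsNoetherianScheme X)
    (M : ZFG.ModuleSheaf V) (hM : ZFG.IsModuleSheaf X M) :
    -- for each sheaf of ideals, the module maps from it to `M` form a set
    (∀ I : V, ZFG.IsIdealSheaf X I → ∃ h : V, ZFG.IsHomSet X I M h) ∧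
    -- for fixed `M`, these sets of maps form a set
    (∃ H : V, ∀ h : V, h ∈ᵥ H ↔ ∃ I : V, ZFG.IsIdealSheaf X I ∧ ZFG.IsHomSet X I M h) ∧
    (∀ I : V, ZFG.IsIdealSheaf X I →
      -- on each Noetherian affine open set, the sheaf of ideals is generated by a finite digraph
      (∀ (U : V) (R : ZFG.RingData V) (θ ρ : V),
        ZFG.IsNoetherianRing R → ZFG.IsAffineChart X U R θ ρ →
          ∃ N E r : V, ZFG.IsFiniteDigraphFor X I U R θ ρ N E r) ∧
      -- on each such open set, the values on the generators determine a module map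
      (∀ (U : V) (R : ZFG.RingData V) (θ ρ N E r φ ψ : V),
        ZFG.IsFiniteDigraphFor X I U R θ ρ N E r →
        ZFG.IsModuleMap X I M φ → ZFG.IsModuleMap X I M ψ →
        ZFG.AgreeOnGenerators X U ρ N φ ψ → ∀ W : V, X.OpenIn U W → ZFG.val φ W = ZFG.val ψ W) ∧
      -- the values on the generators over the members of an affine covering determine a module map
      (∀ C φ ψ : V, ZFG.IsCover (X.OpenIn X.pts) X.pts C →
        ZFG.IsModuleMap X I M φ → ZFG.IsModuleMap X I M ψ →
        (∀ U : V, U ∈ᵥ C → ∃ (R : ZFG.RingData V) (θ ρ N E r : V),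
          ZFG.IsFiniteDigraphFor X I U R θ ρ N E r ∧ ZFG.AgreeOnGenerators X U ρ N φ ψ) →
        φ = ψ)) := by
  have : Fact (ZFG.IsModelZFG0 V) := ⟨hV⟩
  refine ⟨fun I hI => hX.exists_homSet hM hI, hX.exists_homSets M, fun I hI =>
    ⟨fun U R θ ρ hR hc => ZFG.exists_isFiniteDigraphFor hX.1 hR hc hI,
      fun U R θ ρ N E r φ ψ hN hφ hψ h W hW =>
        ZFG.val_eq_val_of_agreeOnGenerators hX.1 hM hI hN hφ hψ h hW,
      fun C φ ψ hC hφ hψ h => hφ.eq_of_cover hX.1 hM hψ hC fun U hU W hW => ?_⟩⟩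
  obtain ⟨R, θ, ρ, N, E, r, hN, hag⟩ := h U hU
  exact ZFG.val_eq_val_of_agreeOnGenerators hX.1 hM hI hN hφ hψ hag hW
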